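/- Let $\varrho\in\mathbb Q$ and let $W(\varrho)[\tfrac12]$ be the complex Lie algebra with basis $\{L_m, Y_p \mid m\in\mathbb Z,\ p\in\mathbb Z+\tfrac12\}$ and brackets $$[L_m,L_n]=(n-m)L_{m+n},\qquad [L_m,Y_p]=(p-m\varrho)Y_{m+p},\qquad [Y_p,Y_q]=0 .$$ A $W(\varrho)[\tfrac12]$-module $V$ is a weight module if it is the sum of its weight spaces $V^\lambda=\{v\in V\mid L_0v=\lambda v\}$, $\lambda\in\mathbb C$. A module is called nontrivial if the Lie algebra does not act on it as zero. For $a,b\in\mathbb C$ let $\mathcal A_{a,b,0}$ be the $W(\varrho)[\tfrac12]$-module with basis $\{v_i\mid i\in\mathbb Z\}$ and actions $L_mv_i=(a+i+bm)v_{m+i}$, $Y_rv_i=0$ for all $m,i\in\mathbb Z$, $r\in\mathbb Z+\tfrac12$. Let $\mathcal A'_{a,b,0}$ be $\mathcal A_{a,b,0}$ if this module is simple, and its nontrivial simple subquotient (unique up to isomorphism) otherwise. For $a,b,c_1,c_2\in\mathbb C$ let $\mathcal A_{a,b,c_1,c_2}$ be the $W(0)[\tfrac12]$-module with basis $\{v_k\mid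 k\in\tfrac12\mathbb Z\}$ and actions $$L_mv_k=(a+bm+k)v_{m+k},\qquad Y_pv_m=c_1v_{p+m},\qquad Y_pv_{m+\frac12}=c_2v_{m+p+\frac12}$$ for all $m\in\mathbb Z$, $k\in\tfrac12\mathbb Z$, $p\in\mathbb Z+\tfrac12$. Let $\mathcal A'_{a,b,c_1,c_2}$ be $\mathcal A_{a,b,c_1,c_2}$ if $c_1c_2\neq0$, and $\mathcal A'_{a,b,0}$ (for $\varrho=0$) if $c_1=0$ or $c_2=0$. **Theorem.** Let $V$ be a nontrivial irreducible weight $W(\varrho)[\tfrac12]$-module all of whose nonzero weight spaces are one-dimensional. (1) If $\varrho=0$, then $V\cong\mathcal A'_{a,b,c_1,c_2}$ for some $a,b,c_1,c_2\in\mathbb C$. (2) If $\varrho\neq0,-1$, then $V\cong\mathcal A'_{a,b,0}$ for some $a,b\in\mathbb C$. -/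

import Mathlib

noncomputable section

namespace WRho

/-- Labels of the standard basis of `W(ϱ)[1/2]`: `L m` stands for `L_m` and
`Y n` stands for `Y_{n + 1/2}`, with `m n : ℤ`. -/
inductive Idx : Type
  | L (m : ℤ) : Idx
  | Y (n : ℤ) : Idx

/-- The underlying vector space of `W(ϱ)[1/2]`: the free complex vector space on the basis
`{L_m, Y_p | m ∈ ℤ, p ∈ ℤ + 1/2}`. -/
def W (_ϱ : ℚ) : Type := Idx →₀ ℂ

instance (ϱ : ℚ) : AddCommGroup (W ϱ) := inferInstanceAs (AddCommGroup (Idx →₀ ℂ))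
instance (ϱ : ℚ) : Module ℂ (W ϱ) := inferInstanceAs (Module ℂ (Idx →₀ ℂ))

/-- The standard basis of `W(ϱ)[1/2]`. -/
def basis (ϱ : ℚ) : Module.Basis Idx ℂ (W ϱ) := ⟨LinearEquiv.refl ℂ (Idx →₀ ℂ)⟩

/-- The element `L_m`. -/
def L (ϱ : ℚ) (m : ℤ) : W ϱ := basis ϱ (Idx.L m)

/-- The element `Y_{n + 1/2}`. -/
def Y (ϱ : ℚ) (n : ℤ) : W ϱ := basis ϱ (Idx.Y n)

/-- The brackets of basis elements: `[L_m, L_n] = (n - m) L_{m+n}`,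
`[L_m, Y_p] = (p - m ϱ) Y_{m+p}`, `[Y_p, Y_q] = 0`. -/
def bracketBasis (ϱ : ℚ) : Idx → Idx → W ϱ
  | .L m, .L n => ((n : ℂ) - m) • L ϱ (m + n)
  | .L m, .Y n => ((n : ℂ) + 1 / 2 - m * ϱ) • Y ϱ (m + n)
  | .Y n, .L m => -(((n : ℂ) + 1 / 2 - m * ϱ) • Y ϱ (m + n))
  | .Y _, .Y _ => 0

/-- The bilinear extension of `bracketBasis`. -/
def bracket (ϱ : ℚ) : W ϱ →ₗ[ℂ] W ϱ →ₗ[ℂ] W ϱ :=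
  (basis ϱ).constr ℂ fun x => (basis ϱ).constr ℂ fun y => bracketBasis ϱ x y

theorem bracket_basis (ϱ : ℚ) (x y : Idx) :
    bracket ϱ (basis ϱ x) (basis ϱ y) = bracketBasis ϱ x y := by
  simp [bracket, Module.Basis.constr_basis]

theorem bracket_skew (ϱ : ℚ) (x y : W ϱ) : bracket ϱ x y = -bracket ϱ y x := by
  have h : bracket ϱ = -(bracket ϱ).flip := by
    refine (basis ϱ).ext fun i => (basis ϱ).ext fun j => ?_
    simp only [LinearMap.neg_apply, LinearMap.flip_apply, bracket_basis]
    rcases i with m | m <;> rcases j with n | n <;> simp only [bracketBasis, neg_neg, neg_zero]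
    rw [← neg_smul, add_comm n m]
    congr 1
    ring
  simpa using congrArg (fun f => f x y) h

theorem bracket_self (ϱ : ℚ) (x : W ϱ) : bracket ϱ x x = 0 := by
  have h : (2 : ℂ) • bracket ϱ x x = 0 := by
    rw [two_smul]
    nth_rewrite 1 [bracket_skew ϱ x x]
    exact neg_add_cancel _
  exact (smul_eq_zero.mp h).resolve_left two_ne_zero

theorem bracket_jacobi (ϱ : ℚ) (x y z : W ϱ) :
    bracket ϱ x (bracket ϱ y z) =
      bracket ϱ (bracket ϱ x y) z + bracket ϱ y (bracket ϱ x z) := by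
  have h : (LinearMap.llcomp ℂ (W ϱ) (W ϱ) (W ϱ)).compl₁₂ (bracket ϱ) (bracket ϱ) =
      (bracket ϱ).compr₂ (bracket ϱ) +
        ((LinearMap.llcomp ℂ (W ϱ) (W ϱ) (W ϱ)).compl₁₂ (bracket ϱ) (bracket ϱ)).flip := by
    refine (basis ϱ).ext fun i => (basis ϱ).ext fun j => (basis ϱ).ext fun k => ?_
    simp only [LinearMap.compl₁₂_apply, LinearMap.llcomp_apply, LinearMap.add_apply,
      LinearMap.compr₂_apply, LinearMap.flip_apply, bracket_basis]
    rcases i with m | m <;> rcases j with n | n <;> rcases k with l | l <;>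
      simp only [bracketBasis, L, Y, map_smul, map_neg, map_zero, LinearMap.smul_apply,
        LinearMap.neg_apply, LinearMap.zero_apply, bracket_basis, smul_zero, neg_zero, add_zero,
        smul_neg, smul_smul, neg_neg]
    all_goals
      push_cast
      simp only [add_comm, add_left_comm]
      module
  simpa using congrArg (fun f => f x y z) h

instance (ϱ : ℚ) : LieRing (W ϱ) where
  bracket x y := bracket ϱ x y
  add_lie x y z := by simp
  lie_add x y z := by simp
  lie_self := bracket_self ϱ
  leibniz_lie := bracket_jacobi ϱ

instance (ϱ : ℚ) : LieAlgebra ℂ (W ϱ) where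
  lie_smul t x y := by
    change bracket ϱ x (t • y) = t • bracket ϱ x y
    simp

/-- The linear map from `W(ϱ)[1/2]` to operators on `M` in which the basis elements act by the
operators `T`. -/
def rep (ϱ : ℚ) {M : Type*} [AddCommGroup M] [Module ℂ M] (T : Idx → Module.End ℂ M) :
    W ϱ →ₗ[ℂ] Module.End ℂ M :=
  (basis ϱ).constr ℂ T

theorem rep_basis (ϱ : ℚ) {M : Type*} [AddCommGroup M] [Module ℂ M]
    (T : Idx → Module.End ℂ M) (i : Idx) : rep ϱ T (basis ϱ i) = T i :=
  (basis ϱ).constr_basis ℂ T i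

theorem rep_lie (ϱ : ℚ) {M : Type*} [AddCommGroup M] [Module ℂ M] (T : Idx → Module.End ℂ M)
    (h : ∀ i j, rep ϱ T (bracketBasis ϱ i j) = T i * T j - T j * T i) (x y : W ϱ) :
    rep ϱ T ⁅x, y⁆ = rep ϱ T x * rep ϱ T y - rep ϱ T y * rep ϱ T x := by
  have key : (bracket ϱ).compr₂ (rep ϱ T) =
      (LinearMap.mul ℂ (Module.End ℂ M) - (LinearMap.mul ℂ (Module.End ℂ M)).flip).compl₁₂
        (rep ϱ T) (rep ϱ T) := by
    refine (basis ϱ).ext fun i => (basis ϱ).ext fun j => ?_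
    simp only [LinearMap.compr₂_apply, bracket_basis, h, LinearMap.compl₁₂_apply, rep_basis]
    rfl
  exact congrArg (fun f => f x y) key

/-- Operators `T` that satisfy the defining relations make `M` a module over `W(ϱ)[1/2]`. -/
@[reducible] def lieRingModuleOf (ϱ : ℚ) {M : Type*} [AddCommGroup M] [Module ℂ M]
    (T : Idx → Module.End ℂ M)
    (h : ∀ i j, rep ϱ T (bracketBasis ϱ i j) = T i * T j - T j * T i) :
    LieRingModule (W ϱ) M where
  bracket x v := rep ϱ T x v
  add_lie x y v := by simp
  lie_add x v w := by simp
  leibniz_lie x y v := by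
    simp [rep_lie ϱ T h]

/-! ### The modules `A_{a,b,0}` over `W(ϱ)[1/2]` -/

/-- The underlying vector space of `A_{a,b,0}`, with basis `v_i`, `i ∈ ℤ`. -/
def A (_ϱ : ℚ) (_a _b : ℂ) : Type := ℤ →₀ ℂ

instance (ϱ : ℚ) (a b : ℂ) : AddCommGroup (A ϱ a b) := inferInstanceAs (AddCommGroup (ℤ →₀ ℂ))
instance (ϱ : ℚ) (a b : ℂ) : Module ℂ (A ϱ a b) := inferInstanceAs (Module ℂ (ℤ →₀ ℂ))

/-- The basis `v_i`, `i ∈ ℤ`, of `A_{a,b,0}`. -/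
def A.v (ϱ : ℚ) (a b : ℂ) : Module.Basis ℤ ℂ (A ϱ a b) := ⟨LinearEquiv.refl ℂ (ℤ →₀ ℂ)⟩

/-- The operators on `A_{a,b,0}`: `L_m v_i = (a + i + b m) v_{m+i}` and `Y_r v_i = 0`. -/
def A.op (ϱ : ℚ) (a b : ℂ) : Idx → Module.End ℂ (A ϱ a b)
  | .L m => (A.v ϱ a b).constr ℂ fun i => (a + i + b * m) • A.v ϱ a b (m + i)
  | .Y _ => 0

theorem A.op_rel (ϱ : ℚ) (a b : ℂ) (i j : Idx) :
    rep ϱ (A.op ϱ a b) (bracketBasis ϱ i j) =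
      A.op ϱ a b i * A.op ϱ a b j - A.op ϱ a b j * A.op ϱ a b i := by
  refine (A.v ϱ a b).ext fun k => ?_
  rcases i with m | m <;> rcases j with n | n <;>
    simp only [bracketBasis, L, Y, map_smul, map_neg, map_zero, Module.Basis.constr_basis,
      LinearMap.smul_apply, rep_basis, LinearMap.sub_apply, Module.End.mul_apply, A.op,
      LinearMap.zero_apply, smul_zero, sub_zero, neg_zero, smul_smul]
  push_cast
  simp only [add_comm, add_left_comm]
  module

instance (ϱ : ℚ) (a b : ℂ) : LieRingModule (W ϱ) (A ϱ a b) :=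
  lieRingModuleOf ϱ (A.op ϱ a b) (A.op_rel ϱ a b)

instance (ϱ : ℚ) (a b : ℂ) : LieModule ℂ (W ϱ) (A ϱ a b) where
  smul_lie t x v := by
    change rep ϱ (A.op ϱ a b) (t • x) v = t • rep ϱ (A.op ϱ a b) x v
    simp
  lie_smul t x v := by
    change rep ϱ (A.op ϱ a b) x (t • v) = t • rep ϱ (A.op ϱ a b) x v
    simp

theorem A.L_lie_v (ϱ : ℚ) (a b : ℂ) (m i : ℤ) :
    ⁅L ϱ m, A.v ϱ a b i⁆ = (a + i + b * m) • A.v ϱ a b (m + i) := by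
  change rep ϱ (A.op ϱ a b) (basis ϱ (.L m)) (A.v ϱ a b i) = _
  rw [rep_basis, A.op, Module.Basis.constr_basis]

theorem A.Y_lie_v (ϱ : ℚ) (a b : ℂ) (n i : ℤ) : ⁅Y ϱ n, A.v ϱ a b i⁆ = 0 := by
  change rep ϱ (A.op ϱ a b) (basis ϱ (.Y n)) (A.v ϱ a b i) = _
  rw [rep_basis, A.op, LinearMap.zero_apply]

/-! ### The modules `A_{a,b,c₁,c₂}` over `W(0)[1/2]` -/

/-- The underlying vector space of `A_{a,b,c₁,c₂}`, with basis `v_k`, `k ∈ (1/2)ℤ`; the basis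
vector `v_k` is labelled by the integer `2 k`. -/
def AA (_a _b _c₁ _c₂ : ℂ) : Type := ℤ →₀ ℂ

instance (a b c₁ c₂ : ℂ) : AddCommGroup (AA a b c₁ c₂) := inferInstanceAs (AddCommGroup (ℤ →₀ ℂ))
instance (a b c₁ c₂ : ℂ) : Module ℂ (AA a b c₁ c₂) := inferInstanceAs (Module ℂ (ℤ →₀ ℂ))

/-- The basis of `A_{a,b,c₁,c₂}`: `AA.v a b c₁ c₂ j` is `v_{j/2}`. -/
def AA.v (a b c₁ c₂ : ℂ) : Module.Basis ℤ ℂ (AA a b c₁ c₂) := ⟨LinearEquiv.refl ℂ (ℤ →₀ ℂ)⟩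

/-- The operators on `A_{a,b,c₁,c₂}`: `L_m v_k = (a + b m + k) v_{m+k}` for `k ∈ (1/2)ℤ`,
`Y_p v_k = c₁ v_{p+k}` for `k ∈ ℤ`, and `Y_p v_k = c₂ v_{p+k}` for `k ∈ ℤ + 1/2`.
Here `k = j/2` and `p = n + 1/2`. -/
def AA.op (a b c₁ c₂ : ℂ) : Idx → Module.End ℂ (AA a b c₁ c₂)
  | .L m => (AA.v a b c₁ c₂).constr ℂ fun j =>
      (a + b * m + (j : ℂ) / 2) • AA.v a b c₁ c₂ (2 * m + j)
  | .Y n => (AA.v a b c₁ c₂).constr ℂ fun j =>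
      (if Even j then c₁ else c₂) • AA.v a b c₁ c₂ (2 * n + 1 + j)

theorem AA.op_rel (a b c₁ c₂ : ℂ) (i j : Idx) :
    rep 0 (AA.op a b c₁ c₂) (bracketBasis 0 i j) =
      AA.op a b c₁ c₂ i * AA.op a b c₁ c₂ j - AA.op a b c₁ c₂ j * AA.op a b c₁ c₂ i := by
  refine (AA.v a b c₁ c₂).ext fun k => ?_
  have e1 : ∀ m : ℤ, Even (2 * m + k) ↔ Even k := fun m => by grind
  have e2 : ∀ m : ℤ, Even (2 * m + 1 + k) ↔ ¬ Even k := fun m => by grind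
  rcases i with m | m <;> rcases j with n | n <;>
    simp only [bracketBasis, L, Y, map_smul, map_neg, map_zero, Module.Basis.constr_basis,
      LinearMap.smul_apply, rep_basis, LinearMap.sub_apply, Module.End.mul_apply, AA.op,
      LinearMap.zero_apply, LinearMap.neg_apply, smul_smul, e1, e2]
  all_goals
    push_cast
    simp only [mul_add, add_assoc, add_comm, add_left_comm]
    by_cases hk : Even k <;> (try simp [hk]) <;> module

instance (a b c₁ c₂ : ℂ) : LieRingModule (W 0) (AA a b c₁ c₂) :=
  lieRingModuleOf 0 (AA.op a b c₁ c₂) (AA.op_rel a b c₁ c₂)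

instance (a b c₁ c₂ : ℂ) : LieModule ℂ (W 0) (AA a b c₁ c₂) where
  smul_lie t x v := by
    change rep 0 (AA.op a b c₁ c₂) (t • x) v = t • rep 0 (AA.op a b c₁ c₂) x v
    simp
  lie_smul t x v := by
    change rep 0 (AA.op a b c₁ c₂) x (t • v) = t • rep 0 (AA.op a b c₁ c₂) x v
    simp

theorem AA.L_lie_v (a b c₁ c₂ : ℂ) (m j : ℤ) :
    ⁅L 0 m, AA.v a b c₁ c₂ j⁆ = (a + b * m + (j : ℂ) / 2) • AA.v a b c₁ c₂ (2 * m + j) := by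
  change rep 0 (AA.op a b c₁ c₂) (basis 0 (.L m)) (AA.v a b c₁ c₂ j) = _
  rw [rep_basis, AA.op, Module.Basis.constr_basis]

theorem AA.Y_lie_v (a b c₁ c₂ : ℂ) (n j : ℤ) :
    ⁅Y 0 n, AA.v a b c₁ c₂ j⁆ =
      (if Even j then c₁ else c₂) • AA.v a b c₁ c₂ (2 * n + 1 + j) := by
  change rep 0 (AA.op a b c₁ c₂) (basis 0 (.Y n)) (AA.v a b c₁ c₂ j) = _
  rw [rep_basis, AA.op, Module.Basis.constr_basis]

/-! ### Weight modules and the simple modules `A'` -/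

section

variable (ϱ : ℚ) (V : Type*) [AddCommGroup V] [Module ℂ V] [LieRingModule (W ϱ) V]
  [LieModule ℂ (W ϱ) V]

/-- The weight space `V^μ = {v ∈ V | L_0 v = μ v}`. -/
def weightSpace (μ : ℂ) : Submodule ℂ V where
  carrier := {v | ⁅L ϱ 0, v⁆ = μ • v}
  add_mem' := by
    intro v w (hv : _ = _) (hw : _ = _)
    change _ = _
    rw [lie_add, hv, hw, smul_add]
  zero_mem' := by simp
  smul_mem' := by
    intro t v (hv : _ = _)
    change _ = _
    rw [lie_smul, hv, smul_comm]

/-- `V` is a weight module: it is the sum of its weight spaces. -/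
def IsWeightModule : Prop := ⨆ μ : ℂ, weightSpace ϱ V μ = ⊤

/-- All weight spaces of `V` (that is, the nonzero spaces `V^μ`) are one-dimensional. -/
def HasMultiplicityOne : Prop :=
  ∀ μ : ℂ, weightSpace ϱ V μ ≠ ⊥ → Module.finrank ℂ (weightSpace ϱ V μ) = 1

/-- `V` is isomorphic to a nontrivial simple subquotient of the module `M`, that is, `V` is
simple with nonzero action and is a quotient of a submodule of `M`. -/
def IsNontrivialSimpleSubquotient (M : Type*) [AddCommGroup M] [Module ℂ M]
    [LieRingModule (W ϱ) M] [LieModule ℂ (W ϱ) M] : Prop :=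
  LieModule.IsIrreducible ℂ (W ϱ) V ∧ ¬ LieModule.IsTrivial (W ϱ) V ∧
    ∃ (N : LieSubmodule ℂ (W ϱ) M) (f : N →ₗ⁅ℂ, W ϱ⁆ V), Function.Surjective f

/-- `V ≅ A'_{a,b,0}`, where `A'_{a,b,0}` is `A_{a,b,0}` itself if that module is simple, and its
nontrivial simple subquotient otherwise. -/
def IsoA' (a b : ℂ) : Prop :=
  (LieModule.IsIrreducible ℂ (W ϱ) (A ϱ a b) ∧ Nonempty (V ≃ₗ⁅ℂ, W ϱ⁆ A ϱ a b)) ∨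
  (¬ LieModule.IsIrreducible ℂ (W ϱ) (A ϱ a b) ∧ IsNontrivialSimpleSubquotient ϱ V (A ϱ a b))

end

/-- `V ≅ A'_{a,b,c₁,c₂}`, where `A'_{a,b,c₁,c₂}` is `A_{a,b,c₁,c₂}` if `c₁ c₂ ≠ 0`, and
`A'_{a,b,0}` if `c₁ = 0` or `c₂ = 0`. -/
def IsoAA' (V : Type*) [AddCommGroup V] [Module ℂ V] [LieRingModule (W 0) V]
    [LieModule ℂ (W 0) V] (a b c₁ c₂ : ℂ) : Prop :=
  (c₁ * c₂ ≠ 0 ∧ Nonempty (V ≃ₗ⁅ℂ, W 0⁆ AA a b c₁ c₂)) ∨ (c₁ * c₂ = 0 ∧ IsoA' 0 V a b)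

end WRho

end

/-!
Let `V` be an irreducible weight module with one-dimensional weight spaces and nonzero action.
Everything is decided far above, in the direction of growing weights. The weights are not bounded
above (`exists_weight_above`): one-dimensionality a few steps below a highest weight forces that
weight to be zero, and a highest weight vector of weight zero is invariant. And since raising
operators can be applied first, `V` is determined by its upper half: if weight vectors
`v_0, v_1, …` of `V`, and vectors `w_0, w_1, …` of another module, transform alike under all
operators that do not lead below `v_0`, then `V` is a subquotient of the other module
(`exists_surjective_of_match`).

*The Witt algebra.* Take a coset of weights that is unbounded above. The scalars by which
`L_{-1} L_1` acts are, far above, the values of a nonvanishing quadratic polynomial in the weight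
(`exists_sl2_string`). The scalars of `L_{-2} L_1²` and `L_{-1}² L_2` are cubic polynomials, and
that of `L_{-2} L_2` is quadratic; the obvious relation between the products of these polynomials
leaves a single parameter `b`, so that far above `L_m` acts as on densities, by `x + b m`
(`exists_density_basis`). If all `Y_p` act as zero, gluing makes `V` a subquotient of `A_{a,b,0}`.

*Nontrivial `Y_p`, `ϱ ≠ -1`.* Then `Y_{1/2}` is injective (`Y_zero_injective`). Otherwise it is
locally nilpotent, the density form of the `L_m` makes the products `Y_p Y_q` with `p, q` large zero
far above, by irreducibility every vector is annihilated by all `Y_p` with `p` large, and this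
contradicts the commutativity of the `Y_p` and the one-dimensionality of the weight spaces
(`not_forall_mem_eventuallyKilled`). In the basis `v_j = Y_{1/2}^j v_0` the operators commuting
with `Y_{1/2}` are multiples of shifts, so every `Y_p` is one, and `L_m` has coefficients linear in
`j` (`exists_shift_basis`). The brackets then give `ϱ (ϱ + 1) = 0` (`rho_eq_of_relations`), and for
`ϱ = 0` exactly the coefficients of `A_{a,b,c,c}` with `c ≠ 0` (`coeff_of_relations`), which is
irreducible.
-/

namespace WRho

/-! ### Brackets, weight vectors and stable subspaces -/

section Basic

theorem W_induction {ϱ : ℚ} {p : W ϱ → Prop} (x : W ϱ) (hb : ∀ i, p (basis ϱ i)) (h0 : p 0)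
    (hadd : ∀ x y, p x → p y → p (x + y)) (hsmul : ∀ (c : ℂ) x, p x → p (c • x)) : p x := by
  have hx : x ∈ Submodule.span ℂ (Set.range (basis ϱ)) := by
    rw [(basis ϱ).span_eq]; trivial
  induction hx using Submodule.span_induction with
  | mem x h => obtain ⟨i, rfl⟩ := h; exact hb i
  | zero => exact h0
  | add x y _ _ hx hy => exact hadd x y hx hy
  | smul c x _ hx => exact hsmul c x hx

theorem Y_lie_Y {ϱ : ℚ} {V : Type*} [AddCommGroup V] [LieRingModule (W ϱ) V]
    (m n : ℤ) (v : V) : ⁅Y ϱ m, ⁅Y ϱ n, v⁆⁆ = ⁅Y ϱ n, ⁅Y ϱ m, v⁆⁆ := by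
  have h : ⁅Y ϱ m, Y ϱ n⁆ = 0 := bracket_basis ϱ (.Y m) (.Y n)
  rw [leibniz_lie, h, zero_lie, zero_add]

variable {ϱ : ℚ} {V : Type*} [AddCommGroup V] [Module ℂ V] [LieRingModule (W ϱ) V]
  [LieModule ℂ (W ϱ) V]

theorem L_lie_L (m n : ℤ) (v : V) :
    ⁅L ϱ m, ⁅L ϱ n, v⁆⁆ = ⁅L ϱ n, ⁅L ϱ m, v⁆⁆ + ((n : ℂ) - m) • ⁅L ϱ (m + n), v⁆ := by
  have h : ⁅L ϱ m, L ϱ n⁆ = ((n : ℂ) - m) • L ϱ (m + n) := bracket_basis ϱ (.L m) (.L n)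
  rw [leibniz_lie, h, smul_lie, add_comm]

theorem L_lie_Y (m n : ℤ) (v : V) :
    ⁅L ϱ m, ⁅Y ϱ n, v⁆⁆ =
      ⁅Y ϱ n, ⁅L ϱ m, v⁆⁆ + ((n : ℂ) + 1 / 2 - m * ϱ) • ⁅Y ϱ (m + n), v⁆ := by
  have h : ⁅L ϱ m, Y ϱ n⁆ = ((n : ℂ) + 1 / 2 - m * ϱ) • Y ϱ (m + n) :=
    bracket_basis ϱ (.L m) (.Y n)
  rw [leibniz_lie, h, smul_lie, add_comm]

theorem mem_weightSpace {μ : ℂ} {v : V} : v ∈ weightSpace ϱ V μ ↔ ⁅L ϱ 0, v⁆ = μ • v := Iff.rfl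

theorem L_mem_weightSpace {μ : ℂ} {v : V} (m : ℤ) (hv : v ∈ weightSpace ϱ V μ) :
    ⁅L ϱ m, v⁆ ∈ weightSpace ϱ V (μ + m) := by
  rw [mem_weightSpace] at *
  rw [L_lie_L, hv, lie_smul, zero_add, ← add_smul]
  push_cast
  congr 1
  ring

theorem Y_mem_weightSpace {μ : ℂ} {v : V} (n : ℤ) (hv : v ∈ weightSpace ϱ V μ) :
    ⁅Y ϱ n, v⁆ ∈ weightSpace ϱ V (μ + n + 1 / 2) := by
  rw [mem_weightSpace] at *
  rw [L_lie_Y, hv, lie_smul, zero_add, ← add_smul]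
  push_cast
  congr 1
  ring

/-- A subspace stable under all `L_m` and `Y_p` is a submodule. -/
def lieSubmoduleOfStable (N : Submodule ℂ V) (hL : ∀ m, ∀ v ∈ N, ⁅L ϱ m, v⁆ ∈ N)
    (hY : ∀ n, ∀ v ∈ N, ⁅Y ϱ n, v⁆ ∈ N) : LieSubmodule ℂ (W ϱ) V where
  toSubmodule := N
  lie_mem {x v} hv := by
    refine W_induction (p := fun x => ⁅x, v⁆ ∈ N) x ?_ ?_ ?_ ?_
    · rintro (m | n)
      · exact hL m v hv
      · exact hY n v hv
    · simp
    · intro x y hx hy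
      rw [add_lie]
      exact N.add_mem hx hy
    · intro c x hx
      rw [smul_lie]
      exact N.smul_mem c hx

/-- In an irreducible module, a stable subspace that contains a nonzero vector is everything. -/
theorem mem_of_stable (hirr : LieModule.IsIrreducible ℂ (W ϱ) V) (N : Submodule ℂ V)
    (hL : ∀ m, ∀ v ∈ N, ⁅L ϱ m, v⁆ ∈ N) (hY : ∀ n, ∀ v ∈ N, ⁅Y ϱ n, v⁆ ∈ N)
    {w : V} (hw : w ∈ N) (hw0 : w ≠ 0) (v : V) : v ∈ N := by
  rcases hirr.eq_bot_or_eq_top (lieSubmoduleOfStable N hL hY) with h | h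
  · have : w ∈ lieSubmoduleOfStable N hL hY := hw
    rw [h] at this
    exact absurd ((LieSubmodule.mem_bot w).1 this) hw0
  · have : v ∈ lieSubmoduleOfStable N hL hY := by rw [h]; trivial
    exact this

/-- One-dimensionality of the weight spaces: a weight vector is a multiple of any given nonzero
vector of the same weight. -/
theorem HasMultiplicityOne.exists_smul (hV : HasMultiplicityOne ϱ V) {μ : ℂ} {v w : V}
    (hv : v ∈ weightSpace ϱ V μ) (hv0 : v ≠ 0) (hw : w ∈ weightSpace ϱ V μ) :
    ∃ c : ℂ, w = c • v := by
  have hne : weightSpace ϱ V μ ≠ ⊥ := fun h => hv0 ((Submodule.mem_bot ℂ).1 (h ▸ hv))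
  have h1 := hV μ hne
  obtain ⟨c, hc⟩ := (finrank_eq_one_iff_of_nonzero' (⟨v, hv⟩ : weightSpace ϱ V μ)
    (by simpa using hv0)).1 h1 ⟨w, hw⟩
  exact ⟨c, by simpa using (congrArg Subtype.val hc).symm⟩

theorem exists_weight_vector [Nontrivial V] (hV : IsWeightModule ϱ V) :
    ∃ (μ : ℂ) (v : V), v ∈ weightSpace ϱ V μ ∧ v ≠ 0 := by
  by_contra! h
  have : (⨆ μ : ℂ, weightSpace ϱ V μ) = ⊥ := by
    rw [iSup_eq_bot]
    intro μ
    rw [Submodule.eq_bot_iff]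
    exact fun v hv => h μ v hv
  rw [IsWeightModule, this] at hV
  exact bot_ne_top hV

end Basic

/-! ### Extremal weight vectors -/

section Extremal

variable {ϱ : ℚ} {V : Type*} [AddCommGroup V] [Module ℂ V] [LieRingModule (W ϱ) V]
  [LieModule ℂ (W ϱ) V]

/-- If `v ≠ 0` of weight `h` is annihilated by `L_1` and `L_2`, then one-dimensionality of the
weight spaces one, two and three steps below forces `h = 0`: the vectors
`L_{-1}² v, L_{-2} v` are dependent only for `16 h² + 10 h = 0`, and the vectors
`L_{-1}³ v, L_{-3} v` only for `h (9 h + 7) = 0`. -/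
theorem weight_eq_zero_of_extremal (hV : HasMultiplicityOne ϱ V) {h : ℂ} {v : V}
    (hv : v ∈ weightSpace ϱ V h) (hv0 : v ≠ 0) (h1 : ⁅L ϱ 1, v⁆ = 0) (h2 : ⁅L ϱ 2, v⁆ = 0) :
    h = 0 := by
  by_contra hh
  have h0 : ⁅L ϱ 0, v⁆ = h • v := hv
  have h3 : ⁅L ϱ 3, v⁆ = 0 := by
    have := L_lie_L (ϱ := ϱ) 1 2 v
    rw [h1, h2, lie_zero, lie_zero] at this
    norm_num at this
    exact this.symm
  set a := ⁅L ϱ (-1), v⁆ with ha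
  set a2 := ⁅L ϱ (-1), a⁆ with ha2
  set a3 := ⁅L ϱ (-1), a2⁆ with ha3
  set b := ⁅L ϱ (-2), v⁆ with hb
  set d := ⁅L ϱ (-3), v⁆ with hd
  have w0a : ⁅L ϱ 0, a⁆ = (h - 1) • a := by
    have := L_mem_weightSpace (-1) hv
    rw [mem_weightSpace] at this
    rw [ha, this]; push_cast; congr 1
  have ma2 : a2 ∈ weightSpace ϱ V (h + (-2 : ℤ)) := by
    have := L_mem_weightSpace (-1) (L_mem_weightSpace (-1) hv)
    convert this using 2
    push_cast; ring
  have ma3 : a3 ∈ weightSpace ϱ V (h + (-3 : ℤ)) := by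
    have := L_mem_weightSpace (-1) ma2
    convert this using 2
    push_cast; ring
  have mb : b ∈ weightSpace ϱ V (h + (-2 : ℤ)) := L_mem_weightSpace (-2) hv
  have md : d ∈ weightSpace ϱ V (h + (-3 : ℤ)) := L_mem_weightSpace (-3) hv
  have w0a2 : ⁅L ϱ 0, a2⁆ = (h - 2) • a2 := by
    rw [mem_weightSpace] at ma2
    rw [ma2]; push_cast; congr 1
  -- the action of `L_1`, `L_2`, `L_3` on the vectors below `v`
  have e1a : ⁅L ϱ 1, a⁆ = (-2 * h) • v := by
    rw [ha, L_lie_L, h1, lie_zero, zero_add]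
    norm_num [h0]
    module
  have e2a : ⁅L ϱ 2, a⁆ = 0 := by
    rw [ha, L_lie_L, h2, lie_zero, zero_add]
    norm_num [h1]
  have e1a2 : ⁅L ϱ 1, a2⁆ = (2 - 4 * h) • a := by
    rw [ha2, L_lie_L, e1a, lie_smul, ← ha]
    norm_num [w0a]
    module
  have e2a2 : ⁅L ϱ 2, a2⁆ = (6 * h) • v := by
    rw [ha2, L_lie_L, e2a, lie_zero, zero_add]
    norm_num [e1a]
    module
  have e3a2 : ⁅L ϱ 3, a2⁆ = 0 := by
    have e3a : ⁅L ϱ 3, a⁆ = 0 := by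
      rw [ha, L_lie_L, h3, lie_zero, zero_add]
      norm_num [h2]
    rw [ha2, L_lie_L, e3a, lie_zero, zero_add]
    norm_num [e2a]
  have e2a3 : ⁅L ϱ 2, a3⁆ = (18 * h - 6) • a := by
    rw [ha3, L_lie_L, e2a2, lie_smul, ← ha]
    norm_num [e1a2]
    module
  have e3a3 : ⁅L ϱ 3, a3⁆ = (-24 * h) • v := by
    rw [ha3, L_lie_L, e3a2, lie_zero, zero_add]
    norm_num [e2a2]
    module
  have e1b : ⁅L ϱ 1, b⁆ = (-3 : ℂ) • a := by
    rw [hb, L_lie_L, h1, lie_zero, zero_add]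
    norm_num [ha]
  have e2b : ⁅L ϱ 2, b⁆ = (-4 * h) • v := by
    rw [hb, L_lie_L, h2, lie_zero, zero_add]
    norm_num [h0]
    module
  have e2d : ⁅L ϱ 2, d⁆ = (-5 : ℂ) • a := by
    rw [hd, L_lie_L, h2, lie_zero, zero_add]
    norm_num [ha]
  have e3d : ⁅L ϱ 3, d⁆ = (-6 * h) • v := by
    rw [hd, L_lie_L, h3, lie_zero, zero_add]
    norm_num [h0]
    module
  have cancel : ∀ {x y : ℂ} {u : V}, u ≠ 0 → x • u = y • u → x = y :=
    fun hu hxy => smul_left_injective ℂ hu hxy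
  have hane : a ≠ 0 := by
    intro ha0
    rw [ha0, lie_zero] at e1a
    rcases smul_eq_zero.1 e1a.symm with h' | h'
    · exact hh (by simpa using h')
    · exact hv0 h'
  have hbne : b ≠ 0 := by
    intro hb0
    rw [hb0, lie_zero] at e2b
    rcases smul_eq_zero.1 e2b.symm with h' | h'
    · exact hh (by simpa using h')
    · exact hv0 h'
  have hdne : d ≠ 0 := by
    intro hd0
    rw [hd0, lie_zero] at e3d
    rcases smul_eq_zero.1 e3d.symm with h' | h'
    · exact hh (by simpa using h')
    · exact hv0 h'
  obtain ⟨s, hs⟩ := hV.exists_smul mb hbne ma2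
  obtain ⟨t, ht⟩ := hV.exists_smul md hdne ma3
  have s1 : 2 - 4 * h = s * (-3) := cancel hane (by rw [← e1a2, hs, lie_smul, e1b, smul_smul])
  have s2 : 6 * h = s * (-4 * h) := cancel hv0 (by rw [← e2a2, hs, lie_smul, e2b, smul_smul])
  have t1 : 18 * h - 6 = t * (-5) := cancel hane (by rw [← e2a3, ht, lie_smul, e2d, smul_smul])
  have t2 : -24 * h = t * (-6 * h) := cancel hv0 (by rw [← e3a3, ht, lie_smul, e3d, smul_smul])
  have s3 : s = -3 / 2 := mul_left_cancel₀ hh (by linear_combination (1 / 4 : ℂ) * s2)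
  have t3 : t = 4 := mul_left_cancel₀ hh (by linear_combination (1 / 6 : ℂ) * t2)
  rw [s3] at s1
  rw [t3] at t1
  have : (0 : ℂ) = 1 := by linear_combination (-4 / 11 : ℂ) * (18 / 4 * s1 + t1)
  exact zero_ne_one this

/-- A weight vector annihilated by all the raising operators is killed by the whole algebra. -/
theorem lie_eq_zero_of_extremal (hV : HasMultiplicityOne ϱ V) {h : ℂ} {v : V}
    (hv : v ∈ weightSpace ϱ V h) (hL : ∀ m : ℤ, 0 < m → ⁅L ϱ m, v⁆ = 0)
    (hY : ∀ n : ℤ, 0 ≤ n → ⁅Y ϱ n, v⁆ = 0) (x : W ϱ) : ⁅x, v⁆ = 0 := by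
  rcases eq_or_ne v 0 with rfl | hv0
  · exact lie_zero x
  have hh : h = 0 := weight_eq_zero_of_extremal hV hv hv0 (hL 1 (by norm_num)) (hL 2 (by norm_num))
  subst hh
  have h0 : ⁅L ϱ 0, v⁆ = 0 := by simpa using mem_weightSpace.1 hv
  have key : ∀ (μ : ℂ) (u : V), μ ≠ 0 → u ∈ weightSpace ϱ V μ → ⁅L ϱ 1, u⁆ = 0 →
      ⁅L ϱ 2, u⁆ = 0 → u = 0 := by
    intro μ u hμ hu h1 h2
    by_contra hu0
    exact hμ (weight_eq_zero_of_extremal hV hu hu0 h1 h2)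
  have hLneg : ∀ k : ℕ, ⁅L ϱ (-k), v⁆ = 0 := by
    intro k
    induction k using Nat.strong_induction_on with
    | _ k ih =>
    have hle : ∀ m : ℤ, -(k : ℤ) < m → ⁅L ϱ m, v⁆ = 0 := by
      intro m hm
      rcases lt_or_ge 0 m with h' | h'
      · exact hL m h'
      · have := ih m.natAbs (by omega)
        rwa [show -(m.natAbs : ℤ) = m by omega] at this
    rcases Nat.eq_zero_or_pos k with rfl | hk
    · simpa using h0
    refine key _ _ ?_ (L_mem_weightSpace (-k) hv) ?_ ?_
    · push_cast
      have : (k : ℂ) ≠ 0 := by exact_mod_cast hk.ne'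
      simpa using this
    · rw [L_lie_L, hL 1 (by norm_num), hle _ (by omega)]; simp
    · rw [L_lie_L, hL 2 (by norm_num), hle _ (by omega)]; simp
  have hYneg : ∀ k : ℕ, ⁅Y ϱ (-k), v⁆ = 0 := by
    intro k
    induction k using Nat.strong_induction_on with
    | _ k ih =>
    have hle : ∀ n : ℤ, -(k : ℤ) < n → ⁅Y ϱ n, v⁆ = 0 := by
      intro n hn
      rcases le_or_gt 0 n with h' | h'
      · exact hY n h'
      · have := ih n.natAbs (by omega)
        rwa [show -(n.natAbs : ℤ) = n by omega] at this
    refine key _ _ ?_ (Y_mem_weightSpace (-k) hv) ?_ ?_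
    · -- a half-integer is not zero
      intro h'
      have h'' : ((1 - 2 * k : ℤ) : ℂ) = 0 := by
        push_cast at h' ⊢
        linear_combination 2 * h'
      have : (1 - 2 * k : ℤ) = 0 := by exact_mod_cast h''
      omega
    · rw [L_lie_Y, hL 1 (by norm_num), hle _ (by omega)]; simp
    · rw [L_lie_Y, hL 2 (by norm_num), hle _ (by omega)]; simp
  refine W_induction (p := fun x => ⁅x, v⁆ = 0) x ?_ (zero_lie v) ?_ ?_
  · rintro (m | n)
    · rcases lt_or_ge 0 m with h' | h'
      · exact hL m h'
      · have := hLneg m.natAbs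
        rwa [show -(m.natAbs : ℤ) = m by omega] at this
    · rcases le_or_gt 0 n with h' | h'
      · exact hY n h'
      · have := hYneg n.natAbs
        rwa [show -(n.natAbs : ℤ) = n by omega] at this
  · intro x y hx hy
    rw [add_lie, hx, hy, add_zero]
  · intro c x hx
    rw [smul_lie, hx, smul_zero]

/-- The weights of a nontrivial irreducible module are not bounded above: above any weight in the
coset `μ + ½ℤ` there is another one. -/
theorem exists_weight_above (hirr : LieModule.IsIrreducible ℂ (W ϱ) V)
    (hnt : ¬ LieModule.IsTrivial (W ϱ) V) (hV : HasMultiplicityOne ϱ V) {μ : ℂ} {v : V}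
    (hv : v ∈ weightSpace ϱ V μ) (hv0 : v ≠ 0) (N : ℤ) :
    ∃ j : ℤ, N ≤ j ∧ weightSpace ϱ V (μ + (j : ℂ) / 2) ≠ ⊥ := by
  by_contra! hN
  obtain ⟨j, hj, hmax⟩ := Int.exists_greatest_of_bdd
    (P := fun j : ℤ => weightSpace ϱ V (μ + (j : ℂ) / 2) ≠ ⊥)
    ⟨N, fun z hz => le_of_not_gt fun h => hz (hN z h.le)⟩
    ⟨0, fun h => hv0 ((Submodule.mem_bot ℂ).1 (h ▸ by simpa using hv))⟩
  obtain ⟨u, hu, hu0⟩ := Submodule.exists_mem_ne_zero_of_ne_bot hj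
  have hzero : ∀ (k : ℤ) (w : V), j < k → w ∈ weightSpace ϱ V (μ + (k : ℂ) / 2) → w = 0 := by
    intro k w hk hw
    by_contra hw0
    exact absurd (hmax k fun h => hw0 ((Submodule.mem_bot ℂ).1 (h ▸ hw))) (not_le.2 hk)
  have hkill : ∀ x : W ϱ, ⁅x, u⁆ = 0 := by
    refine lie_eq_zero_of_extremal hV hu ?_ ?_
    · intro m hm
      refine hzero (j + 2 * m) _ (by omega) ?_
      convert L_mem_weightSpace m hu using 2
      push_cast; ring
    · intro n hn
      refine hzero (j + 2 * n + 1) _ (by omega) ?_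
      convert Y_mem_weightSpace n hu using 2
      push_cast; ring
  refine hnt ⟨fun x w => ?_⟩
  rcases hirr.eq_bot_or_eq_top (LieModule.maxTrivSubmodule ℂ (W ϱ) V) with h | h
  · have : u ∈ LieModule.maxTrivSubmodule ℂ (W ϱ) V :=
      (LieModule.mem_maxTrivSubmodule ℂ (W ϱ) V u).2 hkill
    rw [h] at this
    exact absurd ((LieSubmodule.mem_bot u).1 this) hu0
  · have : w ∈ LieModule.maxTrivSubmodule ℂ (W ϱ) V := by rw [h]; trivial
    exact (LieModule.mem_maxTrivSubmodule ℂ (W ϱ) V w).1 this x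

end Extremal

/-! ### Gluing along an upper half -/

section Gluing

variable {ϱ : ℚ} {V V' : Type*} [AddCommGroup V] [Module ℂ V] [LieRingModule (W ϱ) V]
  [LieModule ℂ (W ϱ) V] [AddCommGroup V'] [Module ℂ V'] [LieRingModule (W ϱ) V']
  [LieModule ℂ (W ϱ) V']

variable (ϱ V V') in
/-- The diagonal action of `x` on `V × V'`. -/
noncomputable def diagAct (x : W ϱ) : Module.End ℂ (V × V') :=
  (LieModule.toEnd ℂ (W ϱ) V x).prodMap (LieModule.toEnd ℂ (W ϱ) V' x)

theorem diagAct_apply (x : W ϱ) (z : V × V') : diagAct ϱ V V' x z = (⁅x, z.1⁆, ⁅x, z.2⁆) := rfl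

theorem diagAct_lie (x y : W ϱ) (z : V × V') :
    diagAct ϱ V V' x (diagAct ϱ V V' y z) =
      diagAct ϱ V V' y (diagAct ϱ V V' x z) + diagAct ϱ V V' ⁅x, y⁆ z := by
  simp only [diagAct_apply, Prod.mk_add_mk]
  rw [leibniz_lie x y z.1, leibniz_lie x y z.2, add_comm, add_comm ⁅⁅x, y⁆, z.2⁆]

/-- The pairs obtained from the pairs `(v j, w j)` by applying lowering operators. -/
inductive Lowered (ϱ : ℚ) {V V' : Type*} [AddCommGroup V] [Module ℂ V] [LieRingModule (W ϱ) V]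
    [LieModule ℂ (W ϱ) V] [AddCommGroup V'] [Module ℂ V'] [LieRingModule (W ϱ) V']
    [LieModule ℂ (W ϱ) V'] (v : ℕ → V) (w : ℕ → V') : V × V' → Prop
  | base (j : ℕ) : Lowered ϱ v w (v j, w j)
  | L (m : ℤ) (hm : m < 0) (z : V × V') (hz : Lowered ϱ v w z) :
      Lowered ϱ v w (diagAct ϱ V V' (WRho.L ϱ m) z)
  | Y (n : ℤ) (hn : n < 0) (z : V × V') (hz : Lowered ϱ v w z) :
      Lowered ϱ v w (diagAct ϱ V V' (WRho.Y ϱ n) z)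

/-- If `V` is irreducible, and a sequence `v j` of weight vectors in `V` of weights `μ + j/2`,
`j ≥ 0`, transforms in the same way as a sequence `w j` in `V'` under those operators `L_m`, `Y_p`
that do not lead out of the range `j ≥ 0`, then `V` is a subquotient of `V'`.

The span `G` of the lowered pairs is a submodule of `V × V'`: a raising operator can be commuted
past the lowering ones until it meets a pair `(v j, w j)`. A lowering operator never leads back, so
in weight `μ` the space `G` is spanned by `(v 0, w 0)`; hence `G` does not contain `(v 0, 0)`, the
submodule `G ∩ (V × 0)` of `V` is zero, and `G` is the graph of a map to `V`. -/
theorem exists_surjective_of_match (hirr : LieModule.IsIrreducible ℂ (W ϱ) V) {μ : ℂ}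
    {v : ℕ → V} {w : ℕ → V'}
    (hv : ∀ j : ℕ, v j ∈ weightSpace ϱ V (μ + (j : ℂ) / 2))
    (hw : ∀ j : ℕ, w j ∈ weightSpace ϱ V' (μ + (j : ℂ) / 2))
    (hv0 : v 0 ≠ 0) (hw0 : w 0 ≠ 0)
    (hL : ∀ (m : ℤ) (i j : ℕ), (j : ℤ) = i + 2 * m →
      ∃ c : ℂ, ⁅L ϱ m, v i⁆ = c • v j ∧ ⁅L ϱ m, w i⁆ = c • w j)
    (hY : ∀ (n : ℤ) (i j : ℕ), (j : ℤ) = i + 2 * n + 1 →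
      ∃ c : ℂ, ⁅Y ϱ n, v i⁆ = c • v j ∧ ⁅Y ϱ n, w i⁆ = c • w j) :
    ∃ (N : LieSubmodule ℂ (W ϱ) V') (f : N →ₗ⁅ℂ, W ϱ⁆ V), Function.Surjective f := by
  set G : Submodule ℂ (V × V') := Submodule.span ℂ {z | Lowered ϱ v w z} with hG
  -- stability of `G`
  have hlowL : ∀ m : ℤ, m < 0 → ∀ z ∈ G, diagAct ϱ V V' (L ϱ m) z ∈ G := by
    intro m hm z hz
    refine Submodule.span_induction (p := fun z _ => diagAct ϱ V V' (L ϱ m) z ∈ G)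
      ?_ ?_ ?_ ?_ hz
    · exact fun z hz => Submodule.subset_span (Lowered.L m hm z hz)
    · rw [map_zero]; exact G.zero_mem
    · intro x y _ _ hx hy
      rw [map_add]; exact G.add_mem hx hy
    · intro c x _ hx
      rw [map_smul]; exact G.smul_mem c hx
  have hlowY : ∀ n : ℤ, n < 0 → ∀ z ∈ G, diagAct ϱ V V' (Y ϱ n) z ∈ G := by
    intro n hn z hz
    refine Submodule.span_induction (p := fun z _ => diagAct ϱ V V' (Y ϱ n) z ∈ G)
      ?_ ?_ ?_ ?_ hz
    · exact fun z hz => Submodule.subset_span (Lowered.Y n hn z hz)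
    · rw [map_zero]; exact G.zero_mem
    · intro x y _ _ hx hy
      rw [map_add]; exact G.add_mem hx hy
    · intro c x _ hx
      rw [map_smul]; exact G.smul_mem c hx
  have hgen : ∀ z, Lowered ϱ v w z → ∀ x : W ϱ, diagAct ϱ V V' x z ∈ G := by
    intro z hz
    induction hz with
    | base j =>
      intro x
      have hbase : ∀ j, (v j, w j) ∈ G := fun j => Submodule.subset_span (Lowered.base j)
      refine W_induction (p := fun x => diagAct ϱ V V' x (v j, w j) ∈ G) x ?_ ?_ ?_ ?_
      · rintro (m | n)
        · rcases lt_or_ge m 0 with hm | hm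
          · exact hlowL m hm _ (hbase j)
          · obtain ⟨c, h1, h2⟩ := hL m j (j + 2 * m).toNat (by omega)
            have : diagAct ϱ V V' (L ϱ m) (v j, w j) = c • (v _, w _) := Prod.ext h1 h2
            change diagAct ϱ V V' (L ϱ m) (v j, w j) ∈ G
            rw [this]
            exact G.smul_mem c (hbase _)
        · rcases lt_or_ge n 0 with hn | hn
          · exact hlowY n hn _ (hbase j)
          · obtain ⟨c, h1, h2⟩ := hY n j (j + 2 * n + 1).toNat (by omega)
            have : diagAct ϱ V V' (Y ϱ n) (v j, w j) = c • (v _, w _) := Prod.ext h1 h2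
            change diagAct ϱ V V' (Y ϱ n) (v j, w j) ∈ G
            rw [this]
            exact G.smul_mem c (hbase _)
      · simp only [diagAct_apply, zero_lie]
        exact G.zero_mem
      · intro x y hx hy
        have := G.add_mem hx hy
        simpa only [diagAct_apply, add_lie, Prod.mk_add_mk] using this
      · intro c x hx
        have := G.smul_mem c hx
        simpa only [diagAct_apply, smul_lie, Prod.smul_mk] using this
    | L m hm z hz ih =>
      intro x
      rw [diagAct_lie]
      exact G.add_mem (hlowL m hm _ (ih x)) (ih _)
    | Y n hn z hz ih =>
      intro x
      rw [diagAct_lie]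
      exact G.add_mem (hlowY n hn _ (ih x)) (ih _)
  have hstable : ∀ (x : W ϱ), ∀ z ∈ G, diagAct ϱ V V' x z ∈ G := by
    intro x z hz
    refine Submodule.span_induction (p := fun z _ => diagAct ϱ V V' x z ∈ G) ?_ ?_ ?_ ?_ hz
    · exact fun z hz => hgen z hz x
    · rw [map_zero]; exact G.zero_mem
    · intro x y _ _ hx hy
      rw [map_add]; exact G.add_mem hx hy
    · intro c x _ hx
      rw [map_smul]; exact G.smul_mem c hx
  -- the weight `μ` part of `G`
  set T := diagAct ϱ V V' (L ϱ 0) with hT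
  have hmemT : ∀ (ν : ℂ) (z : V × V'), z ∈ T.eigenspace ν ↔
      z.1 ∈ weightSpace ϱ V ν ∧ z.2 ∈ weightSpace ϱ V' ν := by
    intro ν z
    rw [Module.End.mem_eigenspace_iff, hT, diagAct_apply, Prod.ext_iff]
    exact Iff.rfl
  have hweight : ∀ z, Lowered ϱ v w z → (∃ (j : ℕ) (c : ℂ), z = c • (v j, w j)) ∨
      ∃ j : ℤ, j < 0 ∧ z ∈ T.eigenspace (μ + (j : ℂ) / 2) := by
    intro z hz
    induction hz with
    | base j => exact Or.inl ⟨j, 1, (one_smul _ _).symm⟩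
    | L m hm z hz ih =>
      rcases ih with ⟨j, c, rfl⟩ | ⟨j, hj, h⟩
      · rcases le_or_gt 0 ((j : ℤ) + 2 * m) with h | h
        · obtain ⟨d, h1, h2⟩ := hL m j (j + 2 * m).toNat (by omega)
          refine Or.inl ⟨(j + 2 * m).toNat, c * d, ?_⟩
          rw [map_smul, mul_smul]
          exact congrArg (c • ·) (Prod.ext h1 h2)
        · refine Or.inr ⟨j + 2 * m, h, ?_⟩
          rw [map_smul]
          refine Submodule.smul_mem _ c ?_
          rw [hmemT, diagAct_apply]
          refine ⟨?_, ?_⟩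
          · convert L_mem_weightSpace m (hv j) using 2
            push_cast; ring
          · convert L_mem_weightSpace m (hw j) using 2
            push_cast; ring
      · refine Or.inr ⟨j + 2 * m, by omega, ?_⟩
        rw [hmemT] at h ⊢
        rw [diagAct_apply]
        refine ⟨?_, ?_⟩
        · convert L_mem_weightSpace m h.1 using 2
          push_cast; ring
        · convert L_mem_weightSpace m h.2 using 2
          push_cast; ring
    | Y n hn z hz ih =>
      rcases ih with ⟨j, c, rfl⟩ | ⟨j, hj, h⟩
      · rcases le_or_gt 0 ((j : ℤ) + 2 * n + 1) with h | h
        · obtain ⟨d, h1, h2⟩ := hY n j (j + 2 * n + 1).toNat (by omega)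
          refine Or.inl ⟨(j + 2 * n + 1).toNat, c * d, ?_⟩
          rw [map_smul, mul_smul]
          exact congrArg (c • ·) (Prod.ext h1 h2)
        · refine Or.inr ⟨j + 2 * n + 1, h, ?_⟩
          rw [map_smul]
          refine Submodule.smul_mem _ c ?_
          rw [hmemT, diagAct_apply]
          refine ⟨?_, ?_⟩
          · convert Y_mem_weightSpace n (hv j) using 2
            push_cast; ring
          · convert Y_mem_weightSpace n (hw j) using 2
            push_cast; ring
      · refine Or.inr ⟨j + 2 * n + 1, by omega, ?_⟩
        rw [hmemT] at h ⊢
        rw [diagAct_apply]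
        refine ⟨?_, ?_⟩
        · convert Y_mem_weightSpace n h.1 using 2
          push_cast; ring
        · convert Y_mem_weightSpace n h.2 using 2
          push_cast; ring
  have hother : ∀ j : ℤ, j ≠ 0 → T.eigenspace (μ + (j : ℂ) / 2) ≤
      ⨆ ν ≠ μ, T.eigenspace ν := by
    intro j hj
    refine le_iSup₂_of_le (μ + (j : ℂ) / 2) ?_ le_rfl
    have : (j : ℂ) ≠ 0 := by exact_mod_cast hj
    simpa using this
  have hGle : G ≤ Submodule.span ℂ {(v 0, w 0)} ⊔ ⨆ ν ≠ μ, T.eigenspace ν := by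
    rw [hG, Submodule.span_le]
    intro z hz
    rcases hweight z hz with ⟨j, c, rfl⟩ | ⟨j, hj, h⟩
    · refine Submodule.smul_mem _ c ?_
      rcases Nat.eq_zero_or_pos j with rfl | hj
      · exact Submodule.mem_sup_left (Submodule.mem_span_singleton_self _)
      · refine Submodule.mem_sup_right (hother j (by omega) ?_)
        rw [hmemT]
        rw [Int.cast_natCast]
        exact ⟨hv j, hw j⟩
    · exact Submodule.mem_sup_right (hother j hj.ne h)
  have hnot : (v 0, (0 : V')) ∉ G := by
    intro h
    obtain ⟨y, hy, r, hr, hyr⟩ := Submodule.mem_sup.1 (hGle h)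
    obtain ⟨c, rfl⟩ := Submodule.mem_span_singleton.1 hy
    have hr' : r ∈ T.eigenspace μ := by
      have : r = (v 0, (0 : V')) - c • (v 0, w 0) := by rw [← hyr]; abel
      rw [this]
      refine Submodule.sub_mem _ ?_ (Submodule.smul_mem _ c ?_)
      · rw [hmemT]
        exact ⟨by simpa using hv 0, Submodule.zero_mem _⟩
      · rw [hmemT]
        exact ⟨by simpa using hv 0, by simpa using hw 0⟩
    have hr0 : r = 0 := by
      have hd := (T.eigenspaces_iSupIndep μ)
      exact (Submodule.disjoint_def.1 hd) r hr' hr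
    rw [hr0, add_zero, Prod.smul_mk, Prod.mk.injEq] at hyr
    rcases smul_eq_zero.1 hyr.2 with hc | hc
    · rw [hc, zero_smul] at hyr
      exact hv0 hyr.1.symm
    · exact hw0 hc
  -- `G` is the graph of a map defined on its second projection
  have hstab' : ∀ (x : W ϱ) (a : V) (b : V'), (a, b) ∈ G → (⁅x, a⁆, ⁅x, b⁆) ∈ G :=
    fun x a b h => hstable x (a, b) h
  have huniq0 : ∀ a : V, (a, (0 : V')) ∈ G → a = 0 := by
    intro a ha
    by_contra ha0
    refine hnot ?_
    refine mem_of_stable hirr (G.comap (LinearMap.inl ℂ V V')) ?_ ?_ (w := a) ha ha0 (v 0)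
    · intro m a ha
      simpa using hstab' (L ϱ m) a 0 ha
    · intro n a ha
      simpa using hstab' (Y ϱ n) a 0 ha
  have huniq : ∀ (a a' : V) (b : V'), (a, b) ∈ G → (a', b) ∈ G → a = a' := by
    intro a a' b h h'
    have := G.sub_mem h h'
    rw [Prod.mk_sub_mk, sub_self] at this
    exact sub_eq_zero.1 (huniq0 _ this)
  let N : LieSubmodule ℂ (W ϱ) V' := lieSubmoduleOfStable (G.map (LinearMap.snd ℂ V V'))
    (by rintro m _ ⟨⟨a, b⟩, h, rfl⟩; exact ⟨_, hstab' (L ϱ m) a b h, rfl⟩)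
    (by rintro m _ ⟨⟨a, b⟩, h, rfl⟩; exact ⟨_, hstab' (Y ϱ m) a b h, rfl⟩)
  have hex : ∀ b : N, ∃ a : V, (a, (b : V')) ∈ G := by
    rintro ⟨_, ⟨⟨a, b⟩, h, rfl⟩⟩
    exact ⟨a, h⟩
  choose f hf using hex
  let F : N →ₗ⁅ℂ, W ϱ⁆ V :=
    { toFun := f
      map_add' := fun b b' => huniq _ _ _ (hf (b + b')) (by
        simpa using G.add_mem (hf b) (hf b'))
      map_smul' := fun c b => huniq _ _ _ (hf (c • b)) (by
        simpa using G.smul_mem c (hf b))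
      map_lie' := fun {x b} => huniq _ _ _ (hf ⁅x, b⁆) (by
        simpa using hstab' x _ _ (hf b)) }
  refine ⟨N, F, fun a => ?_⟩
  have hv0G : (v 0, w 0) ∈ G := Submodule.subset_span (Lowered.base 0)
  obtain ⟨⟨a', b⟩, h, rfl⟩ := mem_of_stable hirr (G.map (LinearMap.fst ℂ V V'))
    (by rintro m _ ⟨⟨a, b⟩, h, rfl⟩; exact ⟨_, hstab' (L ϱ m) a b h, rfl⟩)
    (by rintro m _ ⟨⟨a, b⟩, h, rfl⟩; exact ⟨_, hstab' (Y ϱ m) a b h, rfl⟩)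
    (w := v 0) ⟨_, hv0G, rfl⟩ hv0 a
  exact ⟨⟨b, ⟨_, h, rfl⟩⟩, huniq _ _ b (hf ⟨b, ⟨_, h, rfl⟩⟩) h⟩

end Gluing

/-! ### The Witt algebra far above: density modules -/

/-- A polynomial identity that determines the constants `p, q, e` from `c`, up to the sign of `p`. -/
theorem coeff_of_identity {y₀ c p q e : ℂ}
    (h : ∀ n : ℕ, ∀ y : ℂ, y = y₀ + 2 * n →
      (y ^ 3 + (3 * c - 1) * y + q) * (y ^ 3 + (3 * c - 1) * y + p) =
        (y ^ 2 - y + c) * (y ^ 2 + y + c) * (y ^ 2 + e)) :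
    q = -p ∧ p ^ 2 = c ^ 2 * (1 - 4 * c) := by
  open Polynomial in
  have hall : ∀ y : ℂ, (y ^ 3 + (3 * c - 1) * y + q) * (y ^ 3 + (3 * c - 1) * y + p) =
        (y ^ 2 - y + c) * (y ^ 2 + y + c) * (y ^ 2 + e) := by
    have hP : (X ^ 3 + C (3 * c - 1) * X + C q) * (X ^ 3 + C (3 * c - 1) * X + C p) =
        (X ^ 2 - X + C c) * (X ^ 2 + X + C c) * (X ^ 2 + C e) := by
      refine Polynomial.eq_of_infinite_eval_eq _ _ ?_
      refine (Set.infinite_range_of_injective (f := fun n : ℕ => y₀ + 2 * (n : ℂ)) ?_).mono ?_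
      · intro a b hab
        have : (a : ℂ) = b := by simpa using hab
        exact_mod_cast this
      · rintro _ ⟨n, rfl⟩
        simpa using h n _ rfl
    intro y
    simpa using congrArg (Polynomial.eval y) hP
  have h0 := hall 0
  have h1 := hall 1
  have h1' := hall (-1)
  have h2 := hall 2
  have h2' := hall (-2)
  have hpq : q = -p := by
    linear_combination (1 / 12 : ℂ) * (h2 - h2') - (1 / 6 : ℂ) * (h1 - h1')
  subst hpq
  have hc1 : c * (e - (4 * c - 1)) = 0 := by linear_combination (-1 / 2 : ℂ) * (h1 - h0)
  have hc2 : (2 * c + 3) * (e - (4 * c - 1)) = 0 := by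
    linear_combination (-1 / 4 : ℂ) * (h2 - h0)
  have he : e = 4 * c - 1 := by linear_combination (1 / 3 : ℂ) * (hc2 - 2 * hc1)
  subst he
  exact ⟨rfl, by linear_combination -h0⟩

/-- Here `g j`, `s j`, `t j` are the coefficients of `L_{-1}`, `L_2`, `L_{-2}` in a basis in which
`L_1` is the shift, and the hypotheses are the brackets `[L_1, L_{-2}]`, `[L_{-1}, L_2]` and
`[L_{-2}, L_2]`. With `y = x₀ + j + 1` they make `t j` and `s j * g j * g (j + 1)` cubic polynomials
in `y` that differ by a constant, and `s j * t j` quadratic for even `j`. -/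
theorem exists_density_parameter {x₀ c : ℂ} {s t : ℕ → ℂ} {g : ℕ → ℂ}
    (hg : ∀ j : ℕ, g j = (x₀ + j) ^ 2 + (x₀ + j) + c)
    (ht : ∀ j, t (j + 1) = t j + 3 * g (j + 1))
    (hs : ∀ j, s (j + 1) * g (j + 2) = s j * g j + 3)
    (hst : ∀ j : ℕ, s (j + 2) * t (j + 2) = s j * t j + 4 * (x₀ + j + 2)) :
    ∃ b : ℂ, c = b - b ^ 2 ∧
      (∀ j : ℕ, t j = (x₀ + j + b) * (x₀ + j + 1 + b) * (x₀ + j + 2 - 2 * b)) ∧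
      ∀ j : ℕ, s j * g j * g (j + 1) =
        (x₀ + j + 1 - b) * (x₀ + j + 2 - b) * (x₀ + j + 2 * b) := by
  obtain ⟨p, hp⟩ : ∃ p, p = t 0 - ((x₀ + 1) ^ 3 + (3 * c - 1) * (x₀ + 1)) := ⟨_, rfl⟩
  obtain ⟨q, hq⟩ : ∃ q, q = s 0 * g 0 * g 1 - ((x₀ + 1) ^ 3 + (3 * c - 1) * (x₀ + 1)) := ⟨_, rfl⟩
  obtain ⟨e, he⟩ : ∃ e, e = s 0 * t 0 - (x₀ + 1) ^ 2 := ⟨_, rfl⟩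
  have htp : ∀ j : ℕ, t j = (x₀ + j + 1) ^ 3 + (3 * c - 1) * (x₀ + j + 1) + p := by
    intro j
    induction j with
    | zero => rw [hp]; push_cast; ring
    | succ j ih => rw [ht, ih, hg]; push_cast; ring
  have hsq : ∀ j : ℕ, s j * g j * g (j + 1) =
      (x₀ + j + 1) ^ 3 + (3 * c - 1) * (x₀ + j + 1) + q := by
    intro j
    induction j with
    | zero => rw [hq]; push_cast; ring
    | succ j ih =>
      have h1 : s (j + 1) * g (j + 1) * g (j + 1 + 1) = s j * g j * g (j + 1) + 3 * g (j + 1) := by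
        linear_combination g (j + 1) * hs j
      rw [h1, ih, hg]; push_cast; ring
  have hste : ∀ n : ℕ, s (2 * n) * t (2 * n) = (x₀ + 2 * n + 1) ^ 2 + e := by
    intro n
    induction n with
    | zero => rw [he]; push_cast; ring
    | succ n ih =>
      have := hst (2 * n)
      rw [ih] at this
      rw [show 2 * (n + 1) = 2 * n + 2 by ring, this]; push_cast; ring
  obtain ⟨hqp, hp2⟩ := coeff_of_identity (y₀ := x₀ + 1) (c := c) (p := p) (q := q) (e := e) (by
    intro n y hy
    have h1 := htp (2 * n)
    have h2 := hsq (2 * n)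
    have h3 := hste n
    have h4 := hg (2 * n)
    have h5 := hg (2 * n + 1)
    have e1 : x₀ + ((2 * n : ℕ) : ℂ) + 1 = y := by rw [hy]; push_cast; ring
    have e2 : x₀ + ((2 * n : ℕ) : ℂ) = y - 1 := by rw [← e1]; ring
    have e3 : x₀ + ((2 * n + 1 : ℕ) : ℂ) = y := by rw [← e1]; push_cast; ring
    have e4 : x₀ + 2 * (n : ℂ) + 1 = y := by rw [hy]; ring
    rw [e1] at h1 h2
    rw [e2] at h4
    rw [e3] at h5
    rw [e4] at h3
    rw [← h1, ← h2, show y ^ 2 - y + c = g (2 * n) by rw [h4]; ring,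
      show y ^ 2 + y + c = g (2 * n + 1) by rw [h5], ← h3]
    ring)
  obtain ⟨r, hr⟩ := IsAlgClosed.exists_pow_nat_eq (1 - 4 * c) (n := 2) (by norm_num)
  obtain ⟨b, hb, hpb⟩ : ∃ b : ℂ, c = b - b ^ 2 ∧ p = c * (2 * b - 1) := by
    have : (p - c * r) * (p + c * r) = 0 := by linear_combination hp2 - c ^ 2 * hr
    rcases mul_eq_zero.1 this with h | h
    · exact ⟨(1 + r) / 2, by linear_combination (1 / 4 : ℂ) * hr, by linear_combination h⟩
    · exact ⟨(1 - r) / 2, by linear_combination (1 / 4 : ℂ) * hr, by linear_combination h⟩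
  refine ⟨b, hb, fun j => ?_, fun j => ?_⟩
  · rw [htp, hpb, hb]; ring
  · rw [hsq, hqp, hpb, hb]; ring

section Witt

variable {ϱ : ℚ} {V : Type*} [AddCommGroup V] [Module ℂ V] [LieRingModule (W ϱ) V]
  [LieModule ℂ (W ϱ) V]

/-- If a coset of weights is unbounded above, then from some weight on `L_1` maps every weight
space isomorphically onto the next one, and `L_{-1} L_1` acts by a nonzero quadratic polynomial
in the weight.

Let `γ k` be the scalar by which `L_{-1} L_1` acts in weight `μ + k`. At each weight that occurs it
increases by `2 (μ + k)`, and `γ (k - 1) = γ k = 0` at each weight that does not occur. Thus far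
above the real part of `γ` is nondecreasing, and once positive excludes missing weights. -/
theorem exists_sl2_string (hV : HasMultiplicityOne ϱ V) {μ : ℂ}
    (hunb : ∀ N : ℤ, ∃ k : ℤ, N ≤ k ∧ weightSpace ϱ V (μ + k) ≠ ⊥) (N : ℤ) :
    ∃ (K : ℤ) (c : ℂ) (v : ℕ → V) (g : ℕ → ℂ), N ≤ K ∧
      (∀ j : ℕ, g j = (μ + K + j) ^ 2 + (μ + K + j) + c) ∧ (∀ j, g j ≠ 0) ∧ (∀ j, v j ≠ 0) ∧
      (∀ j : ℕ, v j ∈ weightSpace ϱ V (μ + K + j)) ∧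
      (∀ j, ⁅L ϱ 1, v j⁆ = v (j + 1)) ∧ ∀ j, ⁅L ϱ (-1), v (j + 1)⁆ = g j • v j := by
  have hγ : ∀ k : ℤ, ∃ γ : ℂ, (weightSpace ϱ V (μ + k) = ⊥ → γ = 0) ∧
      ∀ v ∈ weightSpace ϱ V (μ + k), ⁅L ϱ (-1), ⁅L ϱ 1, v⁆⁆ = γ • v := by
    intro k
    by_cases hk : weightSpace ϱ V (μ + k) = ⊥
    · refine ⟨0, fun _ => rfl, fun v hv => ?_⟩
      rw [hk, Submodule.mem_bot] at hv
      rw [hv]; simp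
    · obtain ⟨u, hu, hu0⟩ := Submodule.exists_mem_ne_zero_of_ne_bot hk
      have hu' : ⁅L ϱ (-1), ⁅L ϱ 1, u⁆⁆ ∈ weightSpace ϱ V (μ + k) := by
        convert L_mem_weightSpace (-1) (L_mem_weightSpace 1 hu) using 2
        push_cast; ring
      obtain ⟨γ, hγ⟩ := hV.exists_smul hu hu0 hu'
      refine ⟨γ, fun h => absurd h hk, fun v hv => ?_⟩
      obtain ⟨d, rfl⟩ := hV.exists_smul hu hu0 hv
      rw [lie_smul, lie_smul, hγ, smul_comm]
  choose γ hγ0 hγ using hγ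
  have hrec : ∀ k : ℤ, weightSpace ϱ V (μ + k) ≠ ⊥ → γ k = γ (k - 1) + 2 * (μ + k) := by
    intro k hk
    obtain ⟨u, hu, hu0⟩ := Submodule.exists_mem_ne_zero_of_ne_bot hk
    have hdown : ⁅L ϱ (-1), u⁆ ∈ weightSpace ϱ V (μ + (k - 1 : ℤ)) := by
      convert L_mem_weightSpace (-1) hu using 2
      push_cast; ring
    have h1 : ⁅L ϱ 1, ⁅L ϱ (-1), u⁆⁆ = (γ k - 2 * (μ + k)) • u := by
      rw [L_lie_L, hγ k u hu]
      norm_num [mem_weightSpace.1 hu]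
      module
    by_cases hd : ⁅L ϱ (-1), u⁆ = 0
    · rw [hd, lie_zero] at h1
      have h2 : γ k - 2 * (μ + k) = 0 := (smul_eq_zero.1 h1.symm).resolve_right hu0
      have h3 : γ (k - 1) = 0 := by
        by_cases hk' : weightSpace ϱ V (μ + (k - 1 : ℤ)) = ⊥
        · exact hγ0 _ hk'
        · obtain ⟨w, hw, hw0⟩ := Submodule.exists_mem_ne_zero_of_ne_bot hk'
          have hw' : ⁅L ϱ 1, w⁆ ∈ weightSpace ϱ V (μ + k) := by
            convert L_mem_weightSpace 1 hw using 2
            push_cast; ring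
          obtain ⟨d, hd'⟩ := hV.exists_smul hu hu0 hw'
          have := hγ (k - 1) w hw
          rw [hd', lie_smul, hd, smul_zero] at this
          exact (smul_eq_zero.1 this.symm).resolve_right hw0
      linear_combination h2 - h3
    · have h2 := hγ (k - 1) _ hdown
      rw [h1, lie_smul] at h2
      have := smul_left_injective ℂ hd h2
      linear_combination this
  have hgap : ∀ k : ℤ, weightSpace ϱ V (μ + k) = ⊥ → γ (k - 1) = 0 := by
    intro k hk
    by_cases hk' : weightSpace ϱ V (μ + (k - 1 : ℤ)) = ⊥
    · exact hγ0 _ hk'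
    · obtain ⟨w, hw, hw0⟩ := Submodule.exists_mem_ne_zero_of_ne_bot hk'
      have hw' : ⁅L ϱ 1, w⁆ ∈ weightSpace ϱ V (μ + k) := by
        convert L_mem_weightSpace 1 hw using 2
        push_cast; ring
      rw [hk, Submodule.mem_bot] at hw'
      have := hγ (k - 1) w hw
      rw [hw', lie_zero] at this
      exact (smul_eq_zero.1 this.symm).resolve_right hw0
  -- beyond `N₀` the real parts of the weights are at least `1`
  obtain ⟨N₀, hN₀, hN₀re⟩ : ∃ N₀ : ℤ, N ≤ N₀ ∧ ∀ k : ℤ, N₀ ≤ k → 1 ≤ (μ + k).re := by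
    refine ⟨max N ⌈1 - μ.re⌉, le_max_left _ _, fun k hk => ?_⟩
    have h1 : (⌈1 - μ.re⌉ : ℝ) ≤ k := by exact_mod_cast le_trans (le_max_right _ _) hk
    have h2 := Int.le_ceil (1 - μ.re)
    simp only [Complex.add_re, Complex.intCast_re]
    linarith
  have hstep : ∀ k : ℤ, N₀ ≤ k → weightSpace ϱ V (μ + k) ≠ ⊥ →
      (γ (k - 1)).re + 2 ≤ (γ k).re := by
    intro k hk hk'
    have h1 := hN₀re k hk
    rw [hrec k hk']
    simp only [Complex.add_re, Complex.mul_re, Complex.re_ofNat, Complex.im_ofNat, zero_mul,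
      sub_zero] at h1 ⊢
    linarith
  have hmono : ∀ a k : ℤ, N₀ ≤ a → a ≤ k → (γ a).re ≤ (γ k).re := by
    intro a k ha hak
    induction k, hak using Int.leInduction with
    | base => exact le_rfl
    | succ k hak ih =>
      by_cases hk : weightSpace ϱ V (μ + (k + 1 : ℤ)) = ⊥
      · have h1 := hgap _ hk
        have h2 := hγ0 _ hk
        rw [add_sub_cancel_right] at h1
        rw [h2, ← h1]
        exact ih
      · have := hstep (k + 1) (by omega) hk
        rw [add_sub_cancel_right] at this
        linarith
  obtain ⟨K, hK, hfull, hpos⟩ : ∃ K : ℤ, N₀ ≤ K ∧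
      (∀ k : ℤ, K ≤ k → weightSpace ϱ V (μ + k) ≠ ⊥) ∧ ∀ k : ℤ, K ≤ k → γ k ≠ 0 := by
    by_cases hall : ∀ k : ℤ, N₀ ≤ k → weightSpace ϱ V (μ + k) ≠ ⊥
    · by_cases hz : ∃ k : ℤ, N₀ ≤ k ∧ γ k = 0
      · obtain ⟨a, ha, ha0⟩ := hz
        refine ⟨a + 1, by omega, fun k hk => hall k (by omega), fun k hk h0 => ?_⟩
        have h1 := hstep (a + 1) (by omega) (hall _ (by omega))
        have h2 := hmono (a + 1) k (by omega) hk
        rw [add_sub_cancel_right, ha0, Complex.zero_re] at h1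
        rw [h0, Complex.zero_re] at h2
        linarith
      · exact ⟨N₀, le_rfl, hall, fun k hk h0 => hz ⟨k, hk, h0⟩⟩
    · push Not at hall
      obtain ⟨a, ha, ha0⟩ := hall
      obtain ⟨s, has, hs⟩ := hunb a
      have has' : a ≠ s := fun h => hs (h ▸ ha0)
      have h1 : 2 ≤ (γ s).re := by
        have h2 := hstep s (by omega) hs
        have h3 := hmono a (s - 1) ha (by omega)
        rw [hγ0 a ha0, Complex.zero_re] at h3
        linarith
      have h2 : ∀ k : ℤ, s ≤ k → γ k ≠ 0 := by
        intro k hk h0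
        have := hmono s k (by omega) hk
        rw [h0, Complex.zero_re] at this
        linarith
      exact ⟨s, by omega, fun k hk h => h2 k hk (hγ0 k h), h2⟩
  obtain ⟨u, hu, hu0⟩ := Submodule.exists_mem_ne_zero_of_ne_bot (hfull K le_rfl)
  let v : ℕ → V := fun j => (fun w => ⁅L ϱ 1, w⁆)^[j] u
  have hvs : ∀ j, v (j + 1) = ⁅L ϱ 1, v j⁆ := fun j => Function.iterate_succ_apply' _ _ _
  have hvmem : ∀ j : ℕ, v j ∈ weightSpace ϱ V (μ + (K + j : ℤ)) := by
    intro j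
    induction j with
    | zero => simpa [v] using hu
    | succ j ih =>
      rw [hvs]
      convert L_mem_weightSpace 1 ih using 2
      push_cast; ring
  have hdown : ∀ j : ℕ, ⁅L ϱ (-1), v (j + 1)⁆ = γ (K + j) • v j := by
    intro j
    rw [hvs]
    exact hγ _ _ (hvmem j)
  have hv0 : ∀ j, v j ≠ 0 := by
    intro j
    induction j with
    | zero => exact hu0
    | succ j ih =>
      intro h0
      have := hdown j
      rw [h0, lie_zero] at this
      rcases smul_eq_zero.1 this.symm with h | h
      · exact hpos _ (by omega) h
      · exact ih h
  refine ⟨K, γ K - ((μ + K) ^ 2 + (μ + K)), v, fun j => γ (K + j), by omega, ?_,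
    fun j => hpos _ (by omega), hv0, ?_, fun j => (hvs j).symm, hdown⟩
  · intro j
    induction j with
    | zero => simp
    | succ j ih =>
      have := hrec (K + (j + 1 : ℕ)) (hfull _ (by omega))
      rw [show K + ((j + 1 : ℕ) : ℤ) - 1 = K + j by push_cast; ring] at this
      simp only at ih ⊢
      rw [this, ih]; push_cast; ring
  · intro j
    convert hvmem j using 2
    push_cast; ring

/-- In a module with one-dimensional weight spaces, a coset `μ + ℤ` of weights that is unbounded
above carries, from some weight on, the action of the Witt algebra on densities:
`L_m v_i = (x + b m) v_{i + m}` where `x` is the weight of `v_i`. -/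
theorem exists_density_basis (hV : HasMultiplicityOne ϱ V) {μ : ℂ}
    (hunb : ∀ N : ℤ, ∃ k : ℤ, N ≤ k ∧ weightSpace ϱ V (μ + k) ≠ ⊥) (N : ℤ) :
    ∃ (K : ℤ) (b : ℂ) (v : ℕ → V), N ≤ K ∧ (∀ j, v j ≠ 0) ∧
      (∀ j : ℕ, v j ∈ weightSpace ϱ V (μ + K + j)) ∧
      ∀ (m : ℤ) (i j : ℕ), (j : ℤ) = i + m → ⁅L ϱ m, v i⁆ = (μ + K + i + b * m) • v j := by
  obtain ⟨K, c, v, g, hK, hg, hg0, hv0, hvmem, hup, hdown⟩ := exists_sl2_string hV hunb N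
  obtain ⟨x₀, hx₀⟩ : ∃ x₀ : ℂ, x₀ = μ + K := ⟨_, rfl⟩
  rw [← hx₀] at hg hvmem
  have hs : ∀ j : ℕ, ∃ s : ℂ, ⁅L ϱ 2, v j⁆ = s • v (j + 2) := by
    intro j
    refine hV.exists_smul (hvmem _) (hv0 _) ?_
    convert L_mem_weightSpace 2 (hvmem j) using 2
    push_cast; ring
  have ht : ∀ j : ℕ, ∃ t : ℂ, ⁅L ϱ (-2), v (j + 2)⁆ = t • v j := by
    intro j
    refine hV.exists_smul (hvmem _) (hv0 _) ?_
    convert L_mem_weightSpace (-2) (hvmem (j + 2)) using 2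
    push_cast; ring
  choose s hs using hs
  choose t ht using ht
  have cancel : ∀ {x y : ℂ} (j : ℕ), x • v j = y • v j → x = y :=
    fun j hxy => smul_left_injective ℂ (hv0 j) hxy
  obtain ⟨b, hc, htb, hsb⟩ := exists_density_parameter (s := s) (t := t) hg
    (by
      intro j
      have := L_lie_L (ϱ := ϱ) 1 (-2) (v (j + 2))
      rw [ht, lie_smul, hup, hup, show j + 2 + 1 = j + 1 + 2 by ring, ht] at this
      norm_num at this
      rw [hdown (j + 1), smul_smul, ← neg_smul, ← add_smul] at this
      have := cancel _ this
      linear_combination -this)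
    (by
      intro j
      have := L_lie_L (ϱ := ϱ) (-1) 2 (v (j + 1))
      rw [hs, lie_smul, show j + 1 + 2 = j + 2 + 1 by ring, hdown, hdown, lie_smul, hs] at this
      norm_num at this
      rw [hup, smul_smul, smul_smul, ← add_smul] at this
      have := cancel _ this
      linear_combination this)
    (by
      intro j
      have := L_lie_L (ϱ := ϱ) (-2) 2 (v (j + 2))
      rw [hs, lie_smul, ht, ht, lie_smul, hs] at this
      norm_num [mem_weightSpace.1 (hvmem (j + 2))] at this
      rw [smul_smul, smul_smul, smul_smul, ← add_smul] at this
      have := cancel _ this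
      linear_combination this)
  have hfac : ∀ j : ℕ, g j = (x₀ + j + b) * (x₀ + j + 1 - b) := by
    intro j; rw [hg, hc]; ring
  have hne : ∀ j : ℕ, x₀ + j + b ≠ 0 := fun j h => hg0 j (by rw [hfac, h, zero_mul])
  have hne' : ∀ j : ℕ, x₀ + j + 1 - b ≠ 0 := fun j h => hg0 j (by rw [hfac, h, mul_zero])
  -- the rescaled basis, chosen so that `L_1 w_j = (x + b) w_{j+1}`
  let r : ℕ → ℂ := fun j => ∏ i ∈ Finset.range j, (x₀ + i + b)⁻¹
  have hr : ∀ j, r j = (x₀ + j + b) * r (j + 1) := by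
    intro j
    simp only [r, Finset.prod_range_succ]
    field_simp [hne j]
  have hr0 : ∀ j, r j ≠ 0 := fun j => Finset.prod_ne_zero_iff.2 fun i _ => inv_ne_zero (hne i)
  have l1 : ∀ i : ℕ, ⁅L ϱ 1, r i • v i⁆ = (x₀ + i + b) • r (i + 1) • v (i + 1) := by
    intro i
    rw [lie_smul, hup, smul_smul, ← hr]
  have lm1 : ∀ i : ℕ, ⁅L ϱ (-1), r (i + 1) • v (i + 1)⁆ = (x₀ + i + 1 - b) • r i • v i := by
    intro i
    rw [lie_smul, hdown, smul_smul, smul_smul, hfac, hr i]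
    congr 1; ring
  have l2 : ∀ i : ℕ, ⁅L ϱ 2, r i • v i⁆ = (x₀ + i + 2 * b) • r (i + 2) • v (i + 2) := by
    intro i
    rw [lie_smul, hs, smul_smul, smul_smul, hr i, hr (i + 1)]
    congr 1
    have h1 := hsb i
    have h2 := hne' i
    have h3 := hne' (i + 1)
    rw [hfac, hfac] at h1
    push_cast at h1 h3 ⊢
    refine mul_right_cancel₀ (mul_ne_zero h2 h3) ?_
    linear_combination r (i + 2) * h1
  have lm2 : ∀ i : ℕ, ⁅L ϱ (-2), r (i + 2) • v (i + 2)⁆ = (x₀ + i + 2 - 2 * b) • r i • v i := by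
    intro i
    rw [lie_smul, ht, smul_smul, smul_smul, htb, hr i, hr (i + 1)]
    congr 1
    push_cast; ring
  obtain ⟨w, hw⟩ : ∃ w : ℕ → V, ∀ j, w j = r j • v j := ⟨_, fun _ => rfl⟩
  simp only [← hw] at l1 lm1 l2 lm2
  have hposm : ∀ m : ℕ, ∀ i : ℕ, ⁅L ϱ (m + 1 : ℕ), w i⁆ =
      (x₀ + i + b * (m + 1)) • w (i + (m + 1)) := by
    intro m
    induction m with
    | zero => intro i; simpa using l1 i
    | succ m ih =>
      intro i
      rcases Nat.eq_zero_or_pos m with rfl | hm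
      · have := l2 i
        push_cast
        norm_num
        rw [this, mul_comm]
      · have := L_lie_L (ϱ := ϱ) 1 (m + 1 : ℕ) (w i)
        rw [ih, lie_smul, l1, l1, lie_smul, ih, show i + 1 + (m + 1) = i + (m + 1) + 1 by ring,
          smul_smul, smul_smul] at this
        have hm' : (m : ℂ) ≠ 0 := by exact_mod_cast hm.ne'
        have h2 := sub_eq_iff_eq_add'.2 this
        rw [← sub_smul] at h2
        refine smul_right_injective V hm' ?_
        simp only
        rw [show ((m + 1 + 1 : ℕ) : ℤ) = 1 + ((m + 1 : ℕ) : ℤ) by push_cast; ring,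
          show i + (m + 1 + 1) = i + (m + 1) + 1 by ring]
        convert h2.symm using 1
        · push_cast; congr 1; ring
        · rw [smul_smul]; congr 1; push_cast; ring
  have hnegm : ∀ m : ℕ, ∀ i : ℕ, ⁅L ϱ (-(m + 1 : ℕ)), w (i + (m + 1))⁆ =
      (x₀ + (i + (m + 1)) - b * (m + 1)) • w i := by
    intro m
    induction m with
    | zero => intro i; simpa [add_assoc] using lm1 i
    | succ m ih =>
      intro i
      rcases Nat.eq_zero_or_pos m with rfl | hm
      · have := lm2 i
        push_cast
        norm_num
        rw [this]
        congr 1; ring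
      · have := L_lie_L (ϱ := ϱ) (-1) (-(m + 1 : ℕ)) (w (i + (m + 1) + 1))
        rw [lm1, show i + (m + 1) + 1 = (i + 1) + (m + 1) by ring, ih, lie_smul, lm1, lie_smul,
          ih, smul_smul, smul_smul] at this
        have hm' : -(m : ℂ) ≠ 0 := by
          rw [neg_ne_zero]; exact_mod_cast hm.ne'
        have h2 := sub_eq_iff_eq_add'.2 this
        rw [← sub_smul] at h2
        refine smul_right_injective V hm' ?_
        simp only
        rw [show -((m + 1 + 1 : ℕ) : ℤ) = -1 + -((m + 1 : ℕ) : ℤ) by push_cast; ring,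
          show i + (m + 1 + 1) = i + 1 + (m + 1) by ring]
        convert h2.symm using 1
        · push_cast; congr 1; ring
        · rw [smul_smul]; congr 1; push_cast; ring
  refine ⟨K, b, w, hK, fun j => ?_, fun j => ?_, ?_⟩
  · rw [hw]; exact smul_ne_zero (hr0 j) (hv0 j)
  · rw [hw, ← hx₀]; exact Submodule.smul_mem _ _ (hvmem j)
  · intro m i j hj
    rw [← hx₀]
    rcases lt_trichotomy m 0 with hm | rfl | hm
    · obtain ⟨n, rfl⟩ : ∃ n : ℕ, m = -(n + 1 : ℕ) := ⟨(-m - 1).toNat, by omega⟩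
      obtain rfl : i = j + (n + 1) := by omega
      rw [hnegm]
      congr 1; push_cast; ring
    · obtain rfl : j = i := by omega
      have : w j ∈ weightSpace ϱ V (x₀ + j) := by
        rw [hw]; exact Submodule.smul_mem _ _ (hvmem j)
      rw [mem_weightSpace.1 this]
      simp
    · obtain ⟨n, rfl⟩ : ∃ n : ℕ, m = (n + 1 : ℕ) := ⟨(m - 1).toNat, by omega⟩
      obtain rfl : j = i + (n + 1) := by omega
      rw [hposm]
      congr 1; push_cast; ring

end Witt

/-! ### Injectivity of `Y_{1/2}` -/

section YAction

variable {ϱ : ℚ} {V : Type*} [AddCommGroup V] [Module ℂ V] [LieRingModule (W ϱ) V]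
  [LieModule ℂ (W ϱ) V]

theorem Y_lie_L (m n : ℤ) (v : V) :
    ⁅Y ϱ n, ⁅L ϱ m, v⁆⁆ =
      ⁅L ϱ m, ⁅Y ϱ n, v⁆⁆ - ((n : ℂ) + 1 / 2 - m * ϱ) • ⁅Y ϱ (m + n), v⁆ := by
  rw [L_lie_Y, add_sub_cancel_right]

/-- If `V` is irreducible and some `Y_p` acts nontrivially, then the `Y_p` have no common kernel. -/
theorem exists_Y_lie_ne_zero (hirr : LieModule.IsIrreducible ℂ (W ϱ) V)
    (hY : ∃ (n : ℤ) (v : V), ⁅Y ϱ n, v⁆ ≠ 0) {v : V} (hv : v ≠ 0) : ∃ n : ℤ, ⁅Y ϱ n, v⁆ ≠ 0 := by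
  by_contra! h
  obtain ⟨n, u, hu⟩ := hY
  let N : Submodule ℂ V := ⨅ n : ℤ, LinearMap.ker (LieModule.toEnd ℂ (W ϱ) V (Y ϱ n))
  have hN : ∀ {w : V}, w ∈ N ↔ ∀ n : ℤ, ⁅Y ϱ n, w⁆ = 0 := by
    intro w
    simp [N, Submodule.mem_iInf]
  refine hu (hN.1 (mem_of_stable hirr N ?_ ?_ (hN.2 h) hv u) n)
  · intro m w hw
    refine hN.2 fun n => ?_
    rw [Y_lie_L, hN.1 hw, hN.1 hw, lie_zero, smul_zero, sub_zero]
  · intro m w hw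
    refine hN.2 fun n => ?_
    rw [Y_lie_Y, hN.1 hw, lie_zero]

variable (ϱ V) in
/-- The vectors annihilated by all `Y_p` with `p` sufficiently large. -/
def eventuallyKilled : Submodule ℂ V where
  carrier := {v | ∃ N : ℤ, ∀ n, N ≤ n → ⁅Y ϱ n, v⁆ = 0}
  add_mem' := by
    rintro v w ⟨N, hN⟩ ⟨M, hM⟩
    refine ⟨max N M, fun n hn => ?_⟩
    rw [lie_add, hN n (le_trans (le_max_left _ _) hn), hM n (le_trans (le_max_right _ _) hn),
      add_zero]
  zero_mem' := ⟨0, fun n _ => lie_zero _⟩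
  smul_mem' := by
    rintro c v ⟨N, hN⟩
    exact ⟨N, fun n hn => by rw [lie_smul, hN n hn, smul_zero]⟩

variable (ϱ V) in
/-- The vectors annihilated by all products `Y_p Y_q` with `p` and `q` sufficiently large. -/
def eventuallyKilledTwice : Submodule ℂ V where
  carrier := {v | ∃ N : ℤ, ∀ m n, N ≤ m → N ≤ n → ⁅Y ϱ m, ⁅Y ϱ n, v⁆⁆ = 0}
  add_mem' := by
    rintro v w ⟨N, hN⟩ ⟨M, hM⟩
    refine ⟨max N M, fun m n hm hn => ?_⟩
    rw [lie_add, lie_add, hN m n (le_trans (le_max_left _ _) hm) (le_trans (le_max_left _ _) hn),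
      hM m n (le_trans (le_max_right _ _) hm) (le_trans (le_max_right _ _) hn), add_zero]
  zero_mem' := ⟨0, fun m n _ _ => by rw [lie_zero, lie_zero]⟩
  smul_mem' := by
    rintro c v ⟨N, hN⟩
    exact ⟨N, fun m n hm hn => by rw [lie_smul, lie_smul, hN m n hm hn, smul_zero]⟩

theorem mem_eventuallyKilled_of_ne_zero (hirr : LieModule.IsIrreducible ℂ (W ϱ) V) {w : V}
    (hw : w ∈ eventuallyKilled ϱ V) (hw0 : w ≠ 0) (v : V) : v ∈ eventuallyKilled ϱ V := by
  refine mem_of_stable hirr _ ?_ ?_ hw hw0 v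
  · rintro m v ⟨N, hN⟩
    refine ⟨N + |m|, fun n hn => ?_⟩
    have h1 := abs_nonneg m
    have h2 := neg_abs_le m
    rw [Y_lie_L, hN n (by omega), hN (m + n) (by omega), lie_zero, smul_zero, sub_zero]
  · rintro m v ⟨N, hN⟩
    exact ⟨N, fun n hn => by rw [Y_lie_Y, hN n hn, lie_zero]⟩

theorem mem_eventuallyKilled_of_twice (hirr : LieModule.IsIrreducible ℂ (W ϱ) V) {w : V}
    (hw : w ∈ eventuallyKilledTwice ϱ V) (hw0 : w ≠ 0) (v : V) :
    v ∈ eventuallyKilled ϱ V := by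
  obtain ⟨N, hN⟩ := hw
  by_cases h : ∀ n, N ≤ n → ⁅Y ϱ n, w⁆ = 0
  · exact mem_eventuallyKilled_of_ne_zero hirr ⟨N, h⟩ hw0 v
  · push Not at h
    obtain ⟨n, hn, hne⟩ := h
    exact mem_eventuallyKilled_of_ne_zero hirr ⟨N, fun m hm => hN m n hm hn⟩ hne v

/-- It is impossible that every vector is annihilated by all `Y_p` with `p` large, if the `Y_p`
have no common kernel.

Let `e k` be a vector of weight `μ + k`, and `Y_{q k + 1/2}` the last operator that does not
annihilate it. Commuting `L_{-n}` past the `Y_p` shows that `k + q k` does not change when `k` is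
lowered by `n`, except for at most one `n`. So `k + q k` takes one value for arbitrarily large `k`,
and the last nonzero images of all these `e k` are proportional to one vector `u`. As the `Y_p`
commute, `Y_p u` is then zero whenever some such `k` has `q k + 1/2 < p`; that is, for every `p`. -/
theorem not_forall_mem_eventuallyKilled (hV : HasMultiplicityOne ϱ V) (hϱ : ϱ ≠ -1)
    (hker : ∀ v : V, v ≠ 0 → ∃ n : ℤ, ⁅Y ϱ n, v⁆ ≠ 0) {μ : ℂ}
    (hunb : ∀ N : ℤ, ∃ k : ℤ, N ≤ k ∧ weightSpace ϱ V (μ + k) ≠ ⊥) :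
    ¬ ∀ v : V, v ∈ eventuallyKilled ϱ V := by
  intro hall
  have hϱ' : (1 : ℂ) + ϱ ≠ 0 := by
    intro h
    apply hϱ
    have : ((1 + ϱ : ℚ) : ℂ) = 0 := by push_cast; exact h
    have : (1 + ϱ : ℚ) = 0 := by exact_mod_cast this
    linarith
  have hq : ∀ k : ℤ, weightSpace ϱ V (μ + k) ≠ ⊥ → ∃ (e : V) (q : ℤ),
      e ∈ weightSpace ϱ V (μ + k) ∧ e ≠ 0 ∧ ⁅Y ϱ q, e⁆ ≠ 0 ∧ ∀ n, q < n → ⁅Y ϱ n, e⁆ = 0 := by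
    intro k hk
    obtain ⟨e, he, he0⟩ := Submodule.exists_mem_ne_zero_of_ne_bot hk
    obtain ⟨N, hN⟩ := hall e
    obtain ⟨q, hq, hmax⟩ := Int.exists_greatest_of_bdd (P := fun n : ℤ => ⁅Y ϱ n, e⁆ ≠ 0)
      ⟨N, fun z hz => le_of_not_gt fun h => hz (hN z h.le)⟩ (hker e he0)
    refine ⟨e, q, he, he0, hq, fun n hn => ?_⟩
    by_contra h
    exact absurd (hmax n h) (not_le.2 hn)
  choose! e q he he0 hq hmax using hq
  have hconst : ∀ k k' : ℤ, weightSpace ϱ V (μ + k) ≠ ⊥ → weightSpace ϱ V (μ + k') ≠ ⊥ →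
      k' < k → (q k : ℂ) + 1 / 2 + ((k : ℂ) - k') * (1 + ϱ) ≠ 0 → k' + q k' = k + q k := by
    intro k k' hk hk' hlt hne
    have hmem : ⁅L ϱ (-(k - k')), e k⁆ ∈ weightSpace ϱ V (μ + k') := by
      convert L_mem_weightSpace (-(k - k')) (he k hk) using 2
      push_cast; ring
    obtain ⟨c, hc⟩ := hV.exists_smul (he k' hk') (he0 k' hk') hmem
    have h1 : c • ⁅Y ϱ (q k + (k - k')), e k'⁆ =
        -((q k : ℂ) + 1 / 2 + ((k : ℂ) - k') * (1 + ϱ)) • ⁅Y ϱ (q k), e k⁆ := by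
      rw [← lie_smul, ← hc, Y_lie_L, hmax k hk _ (by omega), lie_zero, zero_sub, ← neg_smul,
        show -(k - k') + (q k + (k - k')) = q k by ring]
      congr 1; push_cast; ring
    have hne' : c • ⁅Y ϱ (q k + (k - k')), e k'⁆ ≠ 0 := by
      rw [h1]; exact smul_ne_zero (neg_ne_zero.2 hne) (hq k hk)
    have hc0 : c ≠ 0 := fun h => hne' (by rw [h, zero_smul])
    have hle : q k + (k - k') ≤ q k' := by
      by_contra h
      exact hne' (by rw [hmax k' hk' _ (by omega), smul_zero])
    have hge : q k' ≤ q k + (k - k') := by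
      by_contra h
      have h2 : c • ⁅Y ϱ (q k'), e k'⁆ = 0 := by
        rw [← lie_smul, ← hc, Y_lie_L, hmax k hk _ (by omega), hmax k hk _ (by omega), lie_zero,
          smul_zero, sub_zero]
      exact hq k' hk' ((smul_eq_zero.1 h2).resolve_left hc0)
    omega
  obtain ⟨k₁, hk₁, hfar⟩ : ∃ k₁ : ℤ, weightSpace ϱ V (μ + k₁) ≠ ⊥ ∧ ∀ M : ℤ, ∃ k : ℤ, M ≤ k ∧
      weightSpace ϱ V (μ + k) ≠ ⊥ ∧ k + q k = k₁ + q k₁ := by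
    obtain ⟨a, -, ha⟩ := hunb 0
    obtain ⟨a', haa', ha'⟩ := hunb (a + 1)
    by_cases h : ∀ M : ℤ, ∃ k : ℤ, M ≤ k ∧ weightSpace ϱ V (μ + k) ≠ ⊥ ∧ k + q k = a + q a
    · exact ⟨a, ha, h⟩
    · push Not at h
      obtain ⟨M, hM⟩ := h
      refine ⟨a', ha', fun M' => ?_⟩
      obtain ⟨k, hk, hk'⟩ := hunb (max (max M M') (a' + 1))
      have hk1 : M ≤ k := le_trans (le_trans (le_max_left _ _) (le_max_left _ _)) hk
      have hk2 : M' ≤ k := le_trans (le_trans (le_max_right _ _) (le_max_left _ _)) hk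
      have hk3 : a' + 1 ≤ k := le_trans (le_max_right _ _) hk
      refine ⟨k, hk2, hk', (hconst k a' hk' ha' (by omega) fun h0' => ?_).symm⟩
      have h0 : (q k : ℂ) + 1 / 2 + ((k : ℂ) - a) * (1 + ϱ) = 0 := by
        by_contra hne
        exact hM k hk1 hk' (hconst k a hk' ha (by omega) hne).symm
      have h1 : ((a' : ℂ) - a) * (1 + ϱ) = 0 := by linear_combination h0 - h0'
      have h2 : ((a' - a : ℤ) : ℂ) = 0 := by
        push_cast
        exact (mul_eq_zero.1 h1).resolve_right hϱ'
      have h3 : a' - a = 0 := by exact_mod_cast h2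
      omega
  obtain ⟨p, hp⟩ := hker _ (hq k₁ hk₁)
  obtain ⟨k, hk, hk', hD⟩ := hfar (k₁ + q k₁ - p + 1)
  have hmem1 : ⁅Y ϱ (q k₁), e k₁⁆ ∈ weightSpace ϱ V (μ + k + q k + 1 / 2) := by
    convert Y_mem_weightSpace (q k₁) (he k₁ hk₁) using 2
    have : (k : ℂ) + q k = k₁ + q k₁ := by exact_mod_cast hD
    linear_combination this
  obtain ⟨c, hc⟩ := hV.exists_smul (Y_mem_weightSpace (q k) (he k hk')) (hq k hk') hmem1
  apply hp
  rw [hc, lie_smul, Y_lie_Y, hmax k hk' p (by omega), lie_zero, smul_zero]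

theorem exists_forall_add_mul_ne_zero {x : ℂ} (hx : x ≠ 0) (b : ℂ) :
    ∃ M : ℤ, 0 ≤ M ∧ ∀ m : ℤ, M ≤ m → x + b * m ≠ 0 := by
  by_cases h : ∃ m₁ : ℤ, x + b * m₁ = 0
  · obtain ⟨m₁, h₁⟩ := h
    refine ⟨|m₁| + 1, by positivity, fun m hm h0 => ?_⟩
    have h2 : b * ((m - m₁ : ℤ) : ℂ) = 0 := by push_cast; linear_combination h0 - h₁
    rcases mul_eq_zero.1 h2 with h3 | h3
    · exact hx (by simpa [h3] using h₁)
    · have h4 : m - m₁ = 0 := by exact_mod_cast h3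
      have := le_abs_self m₁
      omega
  · push Not at h
    exact ⟨0, le_rfl, fun m _ => h m⟩

/-- Far above, each nonzero weight vector `w` generates all sufficiently higher weight spaces
of its coset, by a single `L_m`. -/
theorem exists_far_smul_L (hV : HasMultiplicityOne ϱ V) {μ : ℂ}
    (hunb : ∀ N : ℤ, ∃ k : ℤ, N ≤ k ∧ weightSpace ϱ V (μ + k) ≠ ⊥) :
    ∃ K : ℤ, ∀ k : ℤ, K ≤ k → ∀ w ∈ weightSpace ϱ V (μ + k), w ≠ 0 →
      ∃ M : ℤ, ∀ l : ℤ, M ≤ l → ∀ u ∈ weightSpace ϱ V (μ + l), ∃ c : ℂ,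
        u = c • ⁅L ϱ (l - k), w⁆ := by
  obtain ⟨K, b, v, hK, hv0, hvmem, hL⟩ := exists_density_basis hV hunb ⌈1 - μ.re⌉
  refine ⟨K, fun k hk w hw hw0 => ?_⟩
  obtain ⟨i, rfl⟩ : ∃ i : ℕ, k = K + i := ⟨(k - K).toNat, by omega⟩
  -- the weight of `w` has positive real part
  have hx : μ + K + i ≠ 0 := by
    intro h
    have h1 : (⌈1 - μ.re⌉ : ℝ) ≤ K := by exact_mod_cast hK
    have h2 := Int.le_ceil (1 - μ.re)
    have h3 := congrArg Complex.re h
    simp only [Complex.add_re, Complex.intCast_re, Complex.natCast_re, Complex.zero_re] at h3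
    have h4 : (0 : ℝ) ≤ i := Nat.cast_nonneg i
    linarith
  obtain ⟨M, hM0, hM⟩ := exists_forall_add_mul_ne_zero hx b
  refine ⟨K + i + M, fun l hl u hu => ?_⟩
  obtain ⟨j, rfl⟩ : ∃ j : ℕ, l = K + j := ⟨(l - K).toNat, by omega⟩
  have hvmem' : ∀ j : ℕ, v j ∈ weightSpace ϱ V (μ + (K + j : ℤ)) := by
    intro j
    convert hvmem j using 2
    push_cast; ring
  obtain ⟨d, rfl⟩ := hV.exists_smul (hvmem' i) (hv0 i) hw
  have hd : d ≠ 0 := fun h => hw0 (by rw [h, zero_smul])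
  refine hV.exists_smul ?_ ?_ hu
  · convert L_mem_weightSpace (K + j - (K + i)) hw using 2
    push_cast; ring
  · rw [lie_smul, hL (K + j - (K + i)) i j (by ring)]
    exact smul_ne_zero hd (smul_ne_zero (hM _ (by omega)) (hv0 j))

/-- A single vector `w` annihilated by `Y_{1/2}` makes, far above, all products `Y_p Y_q` with
`p, q` large zero: `Y_{1/2}²` annihilates the vectors `L_m w`, and commutators with the `L_m` turn
the factors `Y_{1/2}` into `Y_p` and `Y_q`. -/
theorem exists_mem_eventuallyKilledTwice {μ : ℂ}
    (hunb : ∀ N : ℤ, ∃ k : ℤ, N ≤ k ∧ weightSpace ϱ V (μ + k) ≠ ⊥) {k M : ℤ} {w : V}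
    (hw : ⁅Y ϱ 0, w⁆ = 0)
    (hM : ∀ l : ℤ, M ≤ l → ∀ u ∈ weightSpace ϱ V (μ + l), ∃ c : ℂ, u = c • ⁅L ϱ (l - k), w⁆) :
    ∃ u ∈ eventuallyKilledTwice ϱ V, u ≠ 0 := by
  have h00 : ∀ l : ℤ, M ≤ l → ∀ u ∈ weightSpace ϱ V (μ + l), ⁅Y ϱ 0, ⁅Y ϱ 0, u⁆⁆ = 0 := by
    intro l hl u hu
    obtain ⟨c, rfl⟩ := hM l hl u hu
    rw [lie_smul, Y_lie_L, hw, lie_zero, zero_sub, lie_smul, lie_neg, lie_smul, Y_lie_Y, hw,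
      lie_zero, smul_zero, neg_zero, smul_zero]
  obtain ⟨M', hM'0, hM'⟩ := exists_forall_add_mul_ne_zero (x := 1 / 2) (by norm_num) (-(ϱ : ℂ))
  have hLmem : ∀ (l m : ℤ) (u : V), u ∈ weightSpace ϱ V (μ + l) →
      ⁅L ϱ m, u⁆ ∈ weightSpace ϱ V (μ + (l + m : ℤ)) := by
    intro l m u hu
    convert L_mem_weightSpace m hu using 2
    push_cast; ring
  have h0m : ∀ l : ℤ, M ≤ l → ∀ u ∈ weightSpace ϱ V (μ + l), ∀ m : ℤ, M' ≤ m →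
      ⁅Y ϱ 0, ⁅Y ϱ m, u⁆⁆ = 0 := by
    intro l hl u hu m hm
    have h1 := h00 (l + m) (by omega) _ (hLmem l m u hu)
    rw [Y_lie_L, lie_sub, Y_lie_L, h00 l hl u hu, lie_zero, zero_sub, lie_smul, add_zero,
      Y_lie_Y m 0, ← neg_smul, ← sub_smul] at h1
    refine (smul_eq_zero.1 h1).resolve_left fun h2 => hM' m hm ?_
    push_cast at h2
    linear_combination (-1 / 2 : ℂ) * h2
  obtain ⟨l, hl, hl'⟩ := hunb M
  obtain ⟨u, hu, hu0⟩ := Submodule.exists_mem_ne_zero_of_ne_bot hl'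
  refine ⟨u, ⟨M', fun m n hm hn => ?_⟩, hu0⟩
  have h1 := h0m (l + m) (by omega) _ (hLmem l m u hu) n hn
  rw [Y_lie_L, lie_sub, Y_lie_L, h0m l hl u hu n hn, lie_zero, zero_sub, lie_smul,
    h0m l hl u hu (m + n) (by omega), smul_zero, sub_zero, add_zero, ← neg_smul] at h1
  refine (smul_eq_zero.1 h1).resolve_left fun h2 => hM' m hm ?_
  push_cast at h2
  linear_combination -h2

/-- On an irreducible module an operator `Y_p` is injective or locally nilpotent: the vectors
annihilated by some power of `Y_p` form a submodule, since `Y_p` commutes with its commutators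
with the `L_m`. -/
theorem exists_pow_Y_eq_zero (hirr : LieModule.IsIrreducible ℂ (W ϱ) V) {n : ℤ} {w : V}
    (hw : ⁅Y ϱ n, w⁆ = 0) (hw0 : w ≠ 0) (v : V) :
    ∃ k : ℕ, (LieModule.toEnd ℂ (W ϱ) V (Y ϱ n) ^ k) v = 0 := by
  set y := LieModule.toEnd ℂ (W ϱ) V (Y ϱ n) with hy
  have hya : ∀ v, y v = ⁅Y ϱ n, v⁆ := fun v => rfl
  have hcomm : ∀ (m : ℤ) (k : ℕ) (v : V), (y ^ k) ⁅Y ϱ m, v⁆ = ⁅Y ϱ m, (y ^ k) v⁆ := by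
    intro m k v
    induction k with
    | zero => rfl
    | succ k ih => rw [pow_succ', Module.End.mul_apply, ih, Module.End.mul_apply, hya, hya, Y_lie_Y]
  have hLk : ∀ (m : ℤ) (k : ℕ) (v : V), (y ^ k) v = 0 → (y ^ (k + 1)) ⁅L ϱ m, v⁆ = 0 := by
    intro m k
    induction k with
    | zero =>
      intro v hv
      have : v = 0 := hv
      rw [this, lie_zero, map_zero]
    | succ k ih =>
      intro v hv
      rw [pow_succ, Module.End.mul_apply, hya, Y_lie_L, map_sub, map_smul, hcomm, hv, lie_zero,
        smul_zero, sub_zero]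
      exact ih _ hv
  have hle : ∀ (k l : ℕ) (v : V), k ≤ l → (y ^ k) v = 0 → (y ^ l) v = 0 := by
    intro k l v hkl hk
    obtain ⟨d, rfl⟩ := Nat.exists_eq_add_of_le hkl
    rw [add_comm, pow_add, Module.End.mul_apply, hk, map_zero]
  let N : Submodule ℂ V :=
    { carrier := {v | ∃ k : ℕ, (y ^ k) v = 0}
      add_mem' := by
        rintro v w ⟨k, hk⟩ ⟨l, hl⟩
        exact ⟨max k l, by rw [map_add, hle k _ v (le_max_left _ _) hk,
          hle l _ w (le_max_right _ _) hl, add_zero]⟩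
      zero_mem' := ⟨0, map_zero _⟩
      smul_mem' := by
        rintro c v ⟨k, hk⟩
        exact ⟨k, by rw [map_smul, hk, smul_zero]⟩ }
  refine mem_of_stable hirr N ?_ ?_ (w := w) ⟨1, by rw [pow_one]; exact hw⟩ hw0 v
  · rintro m v ⟨k, hk⟩
    exact ⟨k + 1, hLk m k v hk⟩
  · rintro m v ⟨k, hk⟩
    exact ⟨k, by rw [hcomm, hk, lie_zero]⟩

/-- If some `Y_p` acts nontrivially and `ϱ ≠ -1`, then `Y_{1/2}` is injective. -/
theorem Y_zero_injective (hirr : LieModule.IsIrreducible ℂ (W ϱ) V)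
    (hV : HasMultiplicityOne ϱ V) (hϱ : ϱ ≠ -1) (hY : ∃ (n : ℤ) (v : V), ⁅Y ϱ n, v⁆ ≠ 0) {μ : ℂ}
    (hunb : ∀ N : ℤ, ∃ k : ℤ, N ≤ k ∧ weightSpace ϱ V (μ + k) ≠ ⊥) {v : V}
    (hv : ⁅Y ϱ 0, v⁆ = 0) : v = 0 := by
  by_contra hv0
  have hker : ∀ v : V, v ≠ 0 → ∃ n : ℤ, ⁅Y ϱ n, v⁆ ≠ 0 :=
    fun v hv => exists_Y_lie_ne_zero hirr hY hv
  have hno := not_forall_mem_eventuallyKilled hV hϱ hker hunb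
  by_cases hunb' : ∀ N : ℤ, ∃ k : ℤ, N ≤ k ∧ weightSpace ϱ V (μ + 1 / 2 + k) ≠ ⊥
  · obtain ⟨K, hK⟩ := exists_far_smul_L hV hunb
    obtain ⟨K', hK'⟩ := exists_far_smul_L hV hunb'
    obtain ⟨k, hk, hk'⟩ := hunb (max K K')
    obtain ⟨e, he, he0⟩ := Submodule.exists_mem_ne_zero_of_ne_bot hk'
    have hnil := exists_pow_Y_eq_zero hirr hv hv0 e
    set y := LieModule.toEnd ℂ (W ϱ) V (Y ϱ 0) with hy
    have hmem : ∀ i : ℕ, (y ^ i) e ∈ weightSpace ϱ V (μ + k + (i : ℂ) / 2) := by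
      intro i
      induction i with
      | zero => simpa using he
      | succ i ih =>
        rw [pow_succ', Module.End.mul_apply]
        change ⁅Y ϱ 0, (y ^ i) e⁆ ∈ _
        convert Y_mem_weightSpace 0 ih using 2
        push_cast; ring
    -- the last nonzero vector `w` in the sequence of the `Y_{1/2}^i e`
    obtain ⟨i, hi, hi'⟩ : ∃ i : ℕ, (y ^ i) e ≠ 0 ∧ (y ^ (i + 1)) e = 0 := by
      by_contra! h
      obtain ⟨i, hi⟩ := hnil
      have : ∀ i : ℕ, (y ^ i) e ≠ 0 := by
        intro i
        induction i with
        | zero => exact he0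
        | succ i ih => exact h i ih
      exact this i hi
    rw [pow_succ', Module.End.mul_apply] at hi'
    have hwt := hmem i
    obtain ⟨u, hu, hu0⟩ : ∃ u ∈ eventuallyKilledTwice ϱ V, u ≠ 0 := by
      rcases Nat.even_or_odd' i with ⟨l, hl | hl⟩
      · obtain ⟨M, hM⟩ := hK (k + l) (by have := le_max_left K K'; omega) ((y ^ i) e)
          (by convert hwt using 2; rw [hl]; push_cast; ring) hi
        exact exists_mem_eventuallyKilledTwice hunb hi' hM
      · obtain ⟨M, hM⟩ := hK' (k + l) (by have := le_max_right K K'; omega) ((y ^ i) e)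
          (by convert hwt using 2; rw [hl]; push_cast; ring) hi
        exact exists_mem_eventuallyKilledTwice hunb' hi' hM
    exact hno (mem_eventuallyKilled_of_twice hirr hu hu0)
  · push Not at hunb'
    obtain ⟨N, hN⟩ := hunb'
    obtain ⟨k, -, hk⟩ := hunb 0
    obtain ⟨e, he, he0⟩ := Submodule.exists_mem_ne_zero_of_ne_bot hk
    refine hno (mem_eventuallyKilled_of_ne_zero hirr (w := e) ⟨N - k, fun n hn => ?_⟩ he0)
    have h1 := Y_mem_weightSpace n he
    rw [show μ + k + n + 1 / 2 = μ + 1 / 2 + (k + n : ℤ) by push_cast; ring,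
      hN (k + n) (by omega), Submodule.mem_bot] at h1
    exact h1

end YAction

/-! ### The module structure when `Y_{1/2}` is injective -/

section Structure

variable {ϱ : ℚ} {V : Type*} [AddCommGroup V] [Module ℂ V] [LieRingModule (W ϱ) V]
  [LieModule ℂ (W ϱ) V]

/-- If `Y_{1/2}` is injective, then in the basis `v_j = Y_{1/2}^j v_0` of the part above the weight
`x₀` of `v_0`, the operator `Y_{n + 1/2}` is a multiple `a n` of the shift by `2 n + 1`, because
it commutes with `Y_{1/2}`; and the coefficient of `L_m` is linear in `j`, because
`[L_m, Y_{1/2}]` is a multiple of a shift. -/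
theorem exists_shift_basis (hV : HasMultiplicityOne ϱ V)
    (hinj : ∀ v : V, ⁅Y ϱ 0, v⁆ = 0 → v = 0) {x₀ : ℂ} {v₀ : V} (hv₀ : v₀ ∈ weightSpace ϱ V x₀)
    (hne : v₀ ≠ 0) :
    ∃ (v : ℕ → V) (a F : ℤ → ℂ), (∀ j, v j ≠ 0) ∧
      (∀ j : ℕ, v j ∈ weightSpace ϱ V (x₀ + (j : ℂ) / 2)) ∧ a 0 = 1 ∧ F 0 = x₀ ∧
      (∀ (n : ℤ) (i j : ℕ), (j : ℤ) = i + 2 * n + 1 → ⁅Y ϱ n, v i⁆ = a n • v j) ∧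
      ∀ (m : ℤ) (i j : ℕ), (j : ℤ) = i + 2 * m →
        ⁅L ϱ m, v i⁆ = (F m + (i : ℂ) / 2 * ((1 - 2 * m * ϱ) * a m)) • v j := by
  obtain ⟨v, hvz, hvs⟩ : ∃ v : ℕ → V, v 0 = v₀ ∧ ∀ j, v (j + 1) = ⁅Y ϱ 0, v j⁆ :=
    ⟨fun j => (fun w => ⁅Y ϱ 0, w⁆)^[j] v₀, rfl, fun j => Function.iterate_succ_apply' _ _ _⟩
  have hv0 : ∀ j, v j ≠ 0 := by
    intro j
    induction j with
    | zero => rw [hvz]; exact hne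
    | succ j ih => rw [hvs]; exact fun h => ih (hinj _ h)
  have hvmem : ∀ j : ℕ, v j ∈ weightSpace ϱ V (x₀ + (j : ℂ) / 2) := by
    intro j
    induction j with
    | zero => rw [hvz]; simpa using hv₀
    | succ j ih =>
      rw [hvs]
      convert Y_mem_weightSpace 0 ih using 2
      push_cast; ring
  have cancel : ∀ {x y : ℂ} (j : ℕ), x • v j = y • v j → x = y :=
    fun j hxy => smul_left_injective ℂ (hv0 j) hxy
  -- a relation between `v i` and `v j` that is invariant under `Y_{1/2}` needs checking only once
  have hpropagate : ∀ P : ℕ → ℕ → Prop, (∀ i j, P i j ↔ P (i + 1) (j + 1)) →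
      ∀ i j i₀ j₀ : ℕ, P i₀ j₀ → j + i₀ = j₀ + i → P i j := by
    intro P hP i j i₀ j₀ h₀ hij
    have hshift : ∀ d i j, P i j ↔ P (i + d) (j + d) := by
      intro d
      induction d with
      | zero => exact fun i j => Iff.rfl
      | succ d ih => exact fun i j => (ih i j).trans (hP _ _)
    rw [hshift i₀, hij, add_comm i i₀]
    exact (hshift i i₀ j₀).1 h₀
  have ha : ∀ n : ℤ, ∃ a : ℂ, ∀ i j : ℕ, (j : ℤ) = i + 2 * n + 1 → ⁅Y ϱ n, v i⁆ = a • v j := by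
    intro n
    obtain ⟨i₀, j₀, h₀⟩ : ∃ i₀ j₀ : ℕ, (j₀ : ℤ) = i₀ + 2 * n + 1 :=
      ⟨2 * n.natAbs, (2 * n.natAbs + 2 * n + 1).toNat, by omega⟩
    obtain ⟨a, ha⟩ : ∃ a : ℂ, ⁅Y ϱ n, v i₀⁆ = a • v j₀ := by
      refine hV.exists_smul (hvmem _) (hv0 _) ?_
      convert Y_mem_weightSpace n (hvmem i₀) using 2
      have : (j₀ : ℂ) = i₀ + 2 * n + 1 := by exact_mod_cast h₀
      rw [this]; ring
    refine ⟨a, fun i j hij => ?_⟩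
    refine hpropagate (fun i j => ⁅Y ϱ n, v i⁆ = a • v j) ?_ i j i₀ j₀ ha (by omega)
    intro i j
    have h1 : ⁅Y ϱ n, v (i + 1)⁆ - a • v (j + 1) = ⁅Y ϱ 0, ⁅Y ϱ n, v i⁆ - a • v j⁆ := by
      rw [hvs, hvs, Y_lie_Y, lie_sub, lie_smul]
    rw [← sub_eq_zero, ← sub_eq_zero (a := ⁅Y ϱ n, v (i + 1)⁆), h1]
    exact ⟨fun h => by rw [h, lie_zero], hinj _⟩
  choose a ha using ha
  have hF : ∀ m : ℤ, ∃ F : ℂ, ∀ i j : ℕ, (j : ℤ) = i + 2 * m →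
      ⁅L ϱ m, v i⁆ = (F + (i : ℂ) / 2 * ((1 - 2 * m * ϱ) * a m)) • v j := by
    intro m
    obtain ⟨i₀, j₀, h₀⟩ : ∃ i₀ j₀ : ℕ, (j₀ : ℤ) = i₀ + 2 * m :=
      ⟨2 * m.natAbs, (2 * m.natAbs + 2 * m).toNat, by omega⟩
    obtain ⟨f, hf⟩ : ∃ f : ℂ, ⁅L ϱ m, v i₀⁆ = f • v j₀ := by
      refine hV.exists_smul (hvmem _) (hv0 _) ?_
      convert L_mem_weightSpace m (hvmem i₀) using 2
      have : (j₀ : ℂ) = i₀ + 2 * m := by exact_mod_cast h₀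
      rw [this]; ring
    obtain ⟨F, hF⟩ : ∃ F : ℂ, f = F + (i₀ : ℂ) / 2 * ((1 - 2 * m * ϱ) * a m) :=
      ⟨f - (i₀ : ℂ) / 2 * ((1 - 2 * m * ϱ) * a m), by ring⟩
    refine ⟨F, fun i j hij => ?_⟩
    refine (hpropagate (fun i j => (j : ℤ) = i + 2 * m →
      ⁅L ϱ m, v i⁆ = (F + (i : ℂ) / 2 * ((1 - 2 * m * ϱ) * a m)) • v j) ?_ i j i₀ j₀
      (fun _ => by rw [hf, hF]) (by omega)) hij
    intro i j
    have hiff : (((j + 1 : ℕ) : ℤ) = (i + 1 : ℕ) + 2 * m) ↔ ((j : ℤ) = i + 2 * m) := by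
      push_cast
      constructor <;> intro h <;> omega
    rw [hiff]
    refine forall_congr' fun h => ?_
    have h1 : ⁅L ϱ m, v (i + 1)⁆ -
        (F + ((i + 1 : ℕ) : ℂ) / 2 * ((1 - 2 * m * ϱ) * a m)) • v (j + 1) =
        ⁅Y ϱ 0, ⁅L ϱ m, v i⁆ - (F + (i : ℂ) / 2 * ((1 - 2 * m * ϱ) * a m)) • v j⁆ := by
      rw [hvs i, L_lie_Y, add_zero, ha m i (j + 1) (by push_cast; omega), lie_sub, lie_smul, ← hvs]
      push_cast
      module
    rw [← sub_eq_zero, ← sub_eq_zero (a := ⁅L ϱ m, v (i + 1)⁆), h1]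
    exact ⟨fun h => by rw [h, lie_zero], hinj _⟩
  choose F hF using hF
  have ha0 : a 0 = 1 := by
    refine cancel 1 ?_
    rw [← ha 0 0 1 (by norm_num), hvs, one_smul]
  refine ⟨v, a, F, hv0, hvmem, ha0, ?_, ha, hF⟩
  have h1 := hF 0 0 0 (by norm_num)
  rw [mem_weightSpace.1 (hvmem 0)] at h1
  simpa using (cancel 0 h1).symm

/-- The relations that the brackets impose on the coefficients of a shift basis, where
`ε m = (1 - 2 m ϱ) a m`. -/
theorem shift_basis_relations {v : ℕ → V} {a F ε : ℤ → ℂ} (hv0 : ∀ j, v j ≠ 0)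
    (hY : ∀ (n : ℤ) (i j : ℕ), (j : ℤ) = i + 2 * n + 1 → ⁅Y ϱ n, v i⁆ = a n • v j)
    (hL : ∀ (m : ℤ) (i j : ℕ), (j : ℤ) = i + 2 * m →
      ⁅L ϱ m, v i⁆ = (F m + (i : ℂ) / 2 * ε m) • v j) (m n : ℤ) :
    a n * (2 * n + 1) * ε m = (2 * n + 1 - 2 * m * ϱ) * a (m + n) ∧
    ((n : ℂ) - m) * (ε m * ε n) = (n - m) * ε (m + n) ∧
    n * (ε m * F n) - m * (ε n * F m) = (n - m) * F (m + n) := by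
  have cancel : ∀ {x y : ℂ} (j : ℕ), x • v j = y • v j → x = y :=
    fun j hxy => smul_left_injective ℂ (hv0 j) hxy
  -- all the indices below are nonnegative
  obtain ⟨d, hd⟩ : ∃ d : ℕ, d = 2 * (m.natAbs + n.natAbs) := ⟨_, rfl⟩
  have key : ∀ i : ℕ, d ≤ i →
      (F m + ((i : ℂ) + 2 * n) / 2 * ε m) * (F n + (i : ℂ) / 2 * ε n) -
      (F n + ((i : ℂ) + 2 * m) / 2 * ε n) * (F m + (i : ℂ) / 2 * ε m) =
      (n - m) * (F (m + n) + (i : ℂ) / 2 * ε (m + n)) := by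
    intro i hi
    obtain ⟨j, hj⟩ : ∃ j : ℕ, (j : ℤ) = i + 2 * n := ⟨(i + 2 * n).toNat, by omega⟩
    obtain ⟨k, hk⟩ : ∃ k : ℕ, (k : ℤ) = i + 2 * m := ⟨(i + 2 * m).toNat, by omega⟩
    obtain ⟨l, hl⟩ : ∃ l : ℕ, (l : ℤ) = i + 2 * (m + n) := ⟨(i + 2 * (m + n)).toNat, by omega⟩
    have hj' : (j : ℂ) = i + 2 * n := by exact_mod_cast hj
    have hk' : (k : ℂ) = i + 2 * m := by exact_mod_cast hk
    have h1 := L_lie_L (ϱ := ϱ) m n (v i)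
    rw [hL n i j hj, hL m i k hk, lie_smul, lie_smul, hL m j l (by omega), hL n k l (by omega),
      hL (m + n) i l hl, smul_smul, smul_smul, smul_smul, ← add_smul] at h1
    have h2 := cancel _ h1
    rw [hj', hk'] at h2
    linear_combination h2
  have k1 := key d le_rfl
  have k2 := key (d + 2) (by omega)
  push_cast at k2
  have hεε : ((n : ℂ) - m) * (ε m * ε n) = (n - m) * ε (m + n) := by
    linear_combination k2 - k1
  refine ⟨?_, hεε, by linear_combination k1 - (d : ℂ) / 2 * hεε⟩
  obtain ⟨j, hj⟩ : ∃ j : ℕ, (j : ℤ) = (d + 1 : ℕ) + 2 * n + 1 :=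
    ⟨((d + 1 : ℕ) + 2 * n + 1).toNat, by omega⟩
  obtain ⟨k, hk⟩ : ∃ k : ℕ, (k : ℤ) = (d + 1 : ℕ) + 2 * m := ⟨((d + 1 : ℕ) + 2 * m).toNat, by omega⟩
  obtain ⟨l, hl⟩ : ∃ l : ℕ, (l : ℤ) = (d + 1 : ℕ) + 2 * (m + n) + 1 :=
    ⟨((d + 1 : ℕ) + 2 * (m + n) + 1).toNat, by omega⟩
  have hj' : (j : ℂ) = (d + 1 : ℕ) + 2 * n + 1 := by exact_mod_cast hj
  have h1 := L_lie_Y (ϱ := ϱ) m n (v (d + 1))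
  rw [hY n _ j hj, hL m _ k hk, lie_smul, lie_smul, hL m j l (by omega), hY n k l (by omega),
    hY (m + n) _ l hl, smul_smul, smul_smul, smul_smul, ← add_smul] at h1
  have h2 := cancel _ h1
  rw [hj'] at h2
  linear_combination 2 * h2

/-- The relations of a shift basis force `ϱ = 0` or `ϱ = -1`: the numbers `ε m` are the powers of
`ε 1`, and the relation for `[L_1, Y_{3/2}]` becomes `4 ϱ (ϱ + 1) = 0`. -/
theorem rho_eq_of_relations {a ε : ℤ → ℂ} (h0 : ε 0 = 1)
    (hε : ∀ m : ℤ, ε m = (1 - 2 * m * ϱ) * a m)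
    (hεε : ∀ m n : ℤ, ((n : ℂ) - m) * (ε m * ε n) = (n - m) * ε (m + n))
    (ha : ∀ m n : ℤ, a n * (2 * n + 1) * ε m = (2 * n + 1 - 2 * m * ϱ) * a (m + n)) :
    ϱ = 0 ∨ ϱ = -1 := by
  have h1 := hεε 1 (-1)
  have h2 := hεε 2 (-1)
  have h3 := ha 1 1
  norm_num [h0] at h1 h2 h3
  have e1 := hε 1
  have e2 := hε 2
  push_cast at e1 e2
  have hε1 : ε 1 ≠ 0 := by
    intro h; rw [h] at h1; norm_num at h1
  have hsq : ε 2 = ε 1 ^ 2 := by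
    linear_combination (-ε 2) * h1 + ε 1 * h2
  have h4 : (4 * ((ϱ : ℂ) * (ϱ + 1))) * ε 1 ^ 2 = 0 := by
    linear_combination (-(1 - 2 * ϱ) * (1 - 4 * ϱ)) * h3 - 3 * ε 1 * (1 - 4 * ϱ) * e1 +
      (3 - 2 * ϱ) * (1 - 2 * ϱ) * (e2 - hsq)
  have h5 : (ϱ : ℂ) * (ϱ + 1) = 0 := by
    have := (mul_eq_zero.1 h4).resolve_right (pow_ne_zero 2 hε1)
    linear_combination (1 / 4 : ℂ) * this
  have h6 : ϱ * (ϱ + 1) = 0 := by exact_mod_cast h5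
  rcases mul_eq_zero.1 h6 with h | h
  · exact Or.inl h
  · exact Or.inr (by linarith)

/-- For `ϱ = 0` the relations of a shift basis determine its coefficients up to three parameters. -/
theorem coeff_of_relations {x₀ : ℂ} {a F : ℤ → ℂ} (h0 : a 0 = 1) (hF0 : F 0 = x₀)
    (haa : ∀ m n : ℤ, ((n : ℂ) - m) * (a m * a n) = (n - m) * a (m + n))
    (hF : ∀ m n : ℤ, n * (a m * F n) - m * (a n * F m) = (n - m) * F (m + n)) :
    ∃ τ b : ℂ, τ ≠ 0 ∧ (∀ n : ℤ, a n = τ ^ n) ∧ ∀ n : ℤ, F n = τ ^ n * (x₀ + b * n) := by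
  have h1 := haa 1 (-1)
  have h2 := haa 2 (-1)
  norm_num [h0] at h1 h2
  have hτ : a 1 ≠ 0 := by
    intro h; rw [h] at h1; norm_num at h1
  have hsq : a 2 = a 1 ^ 2 := by
    linear_combination (-a 2) * h1 + a 1 * h2
  have hsucc : ∀ n : ℤ, a (1 + n) = a 1 * a n := by
    intro n
    by_cases hn : n = 1
    · subst hn
      rw [show (1 : ℤ) + 1 = 2 by norm_num, hsq]; ring
    · have h3 := haa 1 n
      have h4 : ((n : ℂ) - (1 : ℤ)) ≠ 0 := by
        rw [sub_ne_zero]; exact_mod_cast hn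
      exact (mul_left_cancel₀ h4 h3).symm
  have hpow : ∀ n : ℤ, a n = a 1 ^ n := by
    intro n
    induction n using Int.induction_on with
    | zero => rw [h0, zpow_zero]
    | succ n ih => rw [add_comm, hsucc, ih, zpow_add₀ hτ, zpow_one]
    | pred n ih =>
      have h3 := hsucc (-n - 1)
      rw [show (1 : ℤ) + (-n - 1) = -n by ring, ih] at h3
      rw [zpow_sub₀ hτ, zpow_one, h3]
      field_simp
  -- `h n` is the deviation from linearity of `F n / τ ^ n`
  obtain ⟨b, hb⟩ : ∃ b : ℂ, b = F 1 / a 1 - x₀ := ⟨_, rfl⟩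
  obtain ⟨h, hh⟩ : ∃ h : ℤ → ℂ, ∀ n, F n = a 1 ^ n * (x₀ + b * n + h n) := by
    refine ⟨fun n => F n / a 1 ^ n - x₀ - b * n, fun n => ?_⟩
    have := zpow_ne_zero n hτ
    field_simp
    ring
  have hrel : ∀ m n : ℤ, n * h n - m * h m = (n - m) * h (m + n) := by
    intro m n
    have h3 := hF m n
    rw [hpow m, hpow n, hh m, hh n, hh (m + n), zpow_add₀ hτ] at h3
    refine mul_left_cancel₀ (mul_ne_zero (zpow_ne_zero m hτ) (zpow_ne_zero n hτ)) ?_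
    push_cast at h3
    linear_combination h3
  have hz0 : h 0 = 0 := by
    have h3 := hh 0
    rw [hF0, zpow_zero] at h3
    push_cast at h3
    linear_combination -h3
  have hz1 : h 1 = 0 := by
    have h3 := hh 1
    rw [zpow_one] at h3
    have h4 : F 1 = a 1 * (x₀ + b) := by rw [hb]; field_simp; ring
    rw [h4] at h3
    push_cast at h3
    refine mul_left_cancel₀ hτ ?_
    linear_combination -h3
  have hodd : ∀ n : ℤ, n ≠ 0 → h (-n) = -h n := by
    intro n hn
    have h3 := hrel n (-n)
    rw [add_neg_cancel, hz0] at h3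
    have hn' : (n : ℂ) ≠ 0 := by exact_mod_cast hn
    refine mul_left_cancel₀ hn' ?_
    push_cast at h3
    linear_combination -h3
  have hz2 : h 2 = 0 := by
    have h3 := hrel 2 (-1)
    have h4 := hodd 1 one_ne_zero
    norm_num [h4, hz1] at h3
    exact h3
  have hznat : ∀ n : ℕ, h (n + 2 : ℕ) = 0 := by
    intro n
    induction n with
    | zero => exact_mod_cast hz2
    | succ n ih =>
      have h3 := hrel 1 (n + 2 : ℕ)
      rw [ih, hz1, show (1 : ℤ) + (n + 2 : ℕ) = (n + 1 + 2 : ℕ) by push_cast; ring] at h3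
      have h4 : ((n : ℂ) + 1) ≠ 0 := Nat.cast_add_one_ne_zero n
      push_cast at h3 ⊢
      refine mul_left_cancel₀ h4 ?_
      linear_combination -h3
  have hzpos : ∀ n : ℕ, h n = 0 := by
    intro n
    match n with
    | 0 => exact_mod_cast hz0
    | 1 => exact_mod_cast hz1
    | n + 2 => exact hznat n
  have hz : ∀ n : ℤ, h n = 0 := by
    intro n
    rcases Int.eq_nat_or_neg n with ⟨k, rfl | rfl⟩
    · exact hzpos k
    · rcases Nat.eq_zero_or_pos k with rfl | hk
      · simpa using hz0
      · rw [hodd _ (by omega), hzpos, neg_zero]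
  exact ⟨a 1, b, hτ, hpow, fun n => by rw [hh, hz, add_zero]⟩

end Structure

/-! ### Identification of the modules -/

section Identification

/-- A nontrivial quotient of a submodule of an irreducible module is the module itself. -/
theorem nonempty_equiv_of_surjective {ϱ : ℚ} {V M : Type*} [AddCommGroup V] [Module ℂ V]
    [LieRingModule (W ϱ) V] [AddCommGroup M] [Module ℂ M] [LieRingModule (W ϱ) M]
    [Nontrivial V] (hM : LieModule.IsIrreducible ℂ (W ϱ) M)
    {N : LieSubmodule ℂ (W ϱ) M} {f : N →ₗ⁅ℂ, W ϱ⁆ V} (hf : Function.Surjective f) :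
    Nonempty (V ≃ₗ⁅ℂ, W ϱ⁆ M) := by
  obtain ⟨v, hv⟩ := exists_ne (0 : V)
  obtain ⟨n, rfl⟩ := hf v
  have hn : n ≠ 0 := fun h => hv (by rw [h, map_zero])
  have hN : N = ⊤ := by
    refine (hM.eq_bot_or_eq_top N).resolve_left fun h => hn ?_
    have hmem : ∀ x ∈ N, x = 0 := fun x hx => by rwa [h, LieSubmodule.mem_bot] at hx
    exact Subtype.ext (hmem n n.2)
  have hinj : Function.Injective f := by
    rw [injective_iff_map_eq_zero]
    intro x hx
    rcases hM.eq_bot_or_eq_top (f.ker.map N.incl) with h | h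
    · have : (x : M) ∈ f.ker.map N.incl :=
        LieSubmodule.mem_map_of_mem (LieModuleHom.mem_ker.2 hx)
      rw [h, LieSubmodule.mem_bot] at this
      exact Subtype.ext this
    · have : (n : M) ∈ f.ker.map N.incl := by rw [h]; trivial
      obtain ⟨y, hy, hyn⟩ := (LieSubmodule.mem_map _).1 this
      have : y = n := Subtype.ext hyn
      rw [this] at hy
      exact absurd (LieModuleHom.mem_ker.1 hy) hv
  let e : N ≃ₗ⁅ℂ, W ϱ⁆ V :=
    { LinearEquiv.ofBijective (f : N →ₗ[ℂ] V) ⟨hinj, hf⟩ with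
      map_lie' := fun {x m} => f.map_lie x m }
  subst hN
  exact ⟨e.symm.trans (LieModuleEquiv.ofTop ℂ (W ϱ) M)⟩

theorem AA.coord_L_zero (a b c₁ c₂ : ℂ) (k : ℤ) (x : AA a b c₁ c₂) :
    (AA.v a b c₁ c₂).coord k ⁅L 0 0, x⁆ = (a + (k : ℂ) / 2) * (AA.v a b c₁ c₂).coord k x := by
  have : (AA.v a b c₁ c₂).coord k ∘ₗ LieModule.toEnd ℂ (W 0) (AA a b c₁ c₂) (L 0 0) =
      (a + (k : ℂ) / 2) • (AA.v a b c₁ c₂).coord k := by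
    refine (AA.v a b c₁ c₂).ext fun j => ?_
    have h := AA.L_lie_v a b c₁ c₂ 0 j
    simp only [LinearMap.comp_apply, LieModule.toEnd_apply_apply, h, LinearMap.smul_apply,
      map_smul, Module.Basis.coord_apply, mul_zero, zero_add, Module.Basis.repr_self, smul_eq_mul]
    rcases eq_or_ne j k with rfl | hjk
    · simp
    · simp [Finsupp.single_eq_of_ne hjk.symm]
  exact LinearMap.congr_fun this x

/-- A nonzero submodule of `A_{a,b,c₁,c₂}` contains a basis vector: it contains the `L_0`-weight
components of its elements. -/
theorem AA.exists_v_mem (a b c₁ c₂ : ℂ) {N : LieSubmodule ℂ (W 0) (AA a b c₁ c₂)} (hN : N ≠ ⊥) :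
    ∃ j, AA.v a b c₁ c₂ j ∈ N := by
  have key : ∀ (n : ℕ) (x : AA a b c₁ c₂), x ∈ N → x ≠ 0 →
      ((AA.v a b c₁ c₂).repr x).support.card ≤ n → ∃ j, AA.v a b c₁ c₂ j ∈ N := by
    intro n
    induction n with
    | zero =>
      intro x _ hx0 hcard
      rw [Nat.le_zero, Finset.card_eq_zero, Finsupp.support_eq_empty] at hcard
      exact absurd ((LinearEquiv.map_eq_zero_iff _).1 hcard) hx0
    | succ n ih =>
      intro x hx hx0 hcard
      have hrepr : (AA.v a b c₁ c₂).repr x ≠ 0 := fun h =>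
        hx0 ((LinearEquiv.map_eq_zero_iff _).1 h)
      obtain ⟨j, hj⟩ := Finsupp.support_nonempty_iff.2 hrepr
      set y := ⁅L 0 0, x⁆ - (a + (j : ℂ) / 2) • x with hy
      have hyN : y ∈ N := N.sub_mem (N.lie_mem hx) (N.smul_mem _ hx)
      have hyk : ∀ k, (AA.v a b c₁ c₂).repr y k =
          (((k : ℂ) - j) / 2) * (AA.v a b c₁ c₂).repr x k := by
        intro k
        have h1 := AA.coord_L_zero a b c₁ c₂ k x
        rw [Module.Basis.coord_apply, Module.Basis.coord_apply] at h1
        rw [hy, map_sub, map_smul, Finsupp.sub_apply, Finsupp.smul_apply, h1, smul_eq_mul]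
        ring
      rcases eq_or_ne y 0 with hy0 | hy0
      · refine ⟨j, ?_⟩
        have hx' : x = (AA.v a b c₁ c₂).repr x j • AA.v a b c₁ c₂ j := by
          refine (AA.v a b c₁ c₂).ext_elem fun k => ?_
          rw [map_smul, Module.Basis.repr_self, Finsupp.smul_apply, smul_eq_mul]
          rcases eq_or_ne j k with rfl | hjk
          · rw [Finsupp.single_eq_same, mul_one]
          · rw [Finsupp.single_eq_of_ne hjk.symm, mul_zero]
            have h1 := hyk k
            rw [hy0, map_zero, Finsupp.zero_apply] at h1
            refine (mul_eq_zero.1 h1.symm).resolve_left fun h2 => hjk ?_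
            have h3 : (k : ℂ) = j := by linear_combination 2 * h2
            exact_mod_cast h3.symm
        have hne := Finsupp.mem_support_iff.1 hj
        rw [hx'] at hx
        have := N.smul_mem ((AA.v a b c₁ c₂).repr x j)⁻¹ hx
        rwa [smul_smul, inv_mul_cancel₀ hne, one_smul] at this
      · refine ih y hyN hy0 ?_
        have hss : ((AA.v a b c₁ c₂).repr y).support ⊂ ((AA.v a b c₁ c₂).repr x).support := by
          refine (Finset.ssubset_iff_of_subset fun k hk => ?_).2 ⟨j, hj, ?_⟩
          · rw [Finsupp.mem_support_iff, hyk] at hk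
            exact Finsupp.mem_support_iff.2 (right_ne_zero_of_mul hk)
          · rw [Finsupp.notMem_support_iff, hyk, sub_self, zero_div, zero_mul]
        have := Finset.card_lt_card hss
        omega
  obtain ⟨x, hx, hx0⟩ : ∃ x ∈ N, x ≠ 0 := by
    by_contra! h
    exact hN ((LieSubmodule.eq_bot_iff N).2 h)
  exact key _ x hx hx0 le_rfl

theorem AA.isIrreducible (a b : ℂ) {c₁ c₂ : ℂ} (h : c₁ * c₂ ≠ 0) :
    LieModule.IsIrreducible ℂ (W 0) (AA a b c₁ c₂) := by
  have : Nontrivial (AA a b c₁ c₂) := ⟨⟨AA.v a b c₁ c₂ 0, 0, (AA.v a b c₁ c₂).ne_zero 0⟩⟩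
  refine LieModule.IsIrreducible.mk fun N hN => ?_
  obtain ⟨j, hj⟩ := AA.exists_v_mem a b c₁ c₂ hN
  have hstep : ∀ i n : ℤ, AA.v a b c₁ c₂ i ∈ N → AA.v a b c₁ c₂ (2 * n + 1 + i) ∈ N := by
    intro i n hi
    have h1 : ⁅Y 0 n, AA.v a b c₁ c₂ i⁆ ∈ N := N.lie_mem hi
    rw [AA.Y_lie_v] at h1
    obtain ⟨d, hd, hd'⟩ : ∃ d : ℂ, d ≠ 0 ∧ (if Even i then c₁ else c₂) = d := by
      refine ⟨_, ?_, rfl⟩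
      split_ifs
      · exact left_ne_zero_of_mul h
      · exact right_ne_zero_of_mul h
    rw [hd'] at h1
    have := N.smul_mem d⁻¹ h1
    rwa [smul_smul, inv_mul_cancel₀ hd, one_smul] at this
  have hall : ∀ k, AA.v a b c₁ c₂ k ∈ N := by
    intro k
    rcases Int.even_or_odd' (k - j) with ⟨n, hn | hn⟩
    · have h1 := hstep _ n (hstep j (-1) hj)
      rwa [show 2 * n + 1 + (2 * (-1) + 1 + j) = k by omega] at h1
    · have h1 := hstep j n hj
      rwa [show 2 * n + 1 + j = k by omega] at h1
  rw [← LieSubmodule.toSubmodule_eq_top, eq_top_iff, ← (AA.v a b c₁ c₂).span_eq,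
    Submodule.span_le]
  rintro _ ⟨k, rfl⟩
  exact hall k

variable {ϱ : ℚ} {V : Type*} [AddCommGroup V] [Module ℂ V] [LieRingModule (W ϱ) V]
  [LieModule ℂ (W ϱ) V]

theorem exists_unbounded_coset (hirr : LieModule.IsIrreducible ℂ (W ϱ) V)
    (hnt : ¬ LieModule.IsTrivial (W ϱ) V) (hw : IsWeightModule ϱ V)
    (hV : HasMultiplicityOne ϱ V) :
    ∃ μ : ℂ, ∀ N : ℤ, ∃ k : ℤ, N ≤ k ∧ weightSpace ϱ V (μ + k) ≠ ⊥ := by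
  have : Nontrivial V := LieModule.nontrivial_of_isIrreducible ℂ (W ϱ) V
  obtain ⟨μ, v, hv, hv0⟩ := exists_weight_vector hw
  by_cases h : ∀ N : ℤ, ∃ k : ℤ, N ≤ k ∧ weightSpace ϱ V (μ + k) ≠ ⊥
  · exact ⟨μ, h⟩
  · push Not at h
    obtain ⟨N₀, hN₀⟩ := h
    refine ⟨μ + 1 / 2, fun N => ?_⟩
    obtain ⟨j, hj, hj'⟩ := exists_weight_above hirr hnt hV hv hv0 (2 * max N N₀ + 1)
    have h1 := le_max_left N N₀
    have h2 := le_max_right N N₀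
    rcases Int.even_or_odd' j with ⟨k, rfl | rfl⟩
    · refine absurd ?_ hj'
      rw [← hN₀ k (by omega)]
      congr 1; push_cast; ring
    · refine ⟨k, by omega, ?_⟩
      convert hj' using 2
      push_cast; ring

/-- If the `Y_p` act as zero, the module is a density module or a subquotient of one. -/
theorem exists_isoA'_of_Y_lie_eq_zero (hirr : LieModule.IsIrreducible ℂ (W ϱ) V)
    (hnt : ¬ LieModule.IsTrivial (W ϱ) V) (hw : IsWeightModule ϱ V)
    (hV : HasMultiplicityOne ϱ V) (hY : ∀ (n : ℤ) (v : V), ⁅Y ϱ n, v⁆ = 0) :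
    ∃ a b : ℂ, IsoA' ϱ V a b := by
  have : Nontrivial V := LieModule.nontrivial_of_isIrreducible ℂ (W ϱ) V
  obtain ⟨μ, hμ⟩ := exists_unbounded_coset hirr hnt hw hV
  obtain ⟨K, b, v, -, hv0, hvmem, hL⟩ := exists_density_basis hV hμ 0
  -- the vectors `v j` have weights in `μ + K + ℤ`; the weights in `μ + K + 1/2 + ℤ` are filled by `0`
  let v' : ℕ → V := fun j => if Even j then v (j / 2) else 0
  let w' : ℕ → A ϱ (μ + K) b := fun j => if Even j then A.v ϱ (μ + K) b (j / 2 : ℕ) else 0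
  obtain ⟨N, f, hf⟩ : ∃ (N : LieSubmodule ℂ (W ϱ) (A ϱ (μ + K) b)) (f : N →ₗ⁅ℂ, W ϱ⁆ V),
      Function.Surjective f := by
    refine exists_surjective_of_match hirr (μ := μ + K) (v := v') (w := w') ?_ ?_ ?_ ?_ ?_ ?_
    · intro j
      rcases Nat.even_or_odd' j with ⟨k, rfl | rfl⟩
      · convert hvmem k using 1
        · push_cast; congr 1; ring
        · simp [v']
      · have : v' (2 * k + 1) = 0 := by simp [v']
        rw [this]; exact Submodule.zero_mem _
    · intro j
      rcases Nat.even_or_odd' j with ⟨k, rfl | rfl⟩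
      · have : w' (2 * k) = A.v ϱ (μ + K) b k := by simp [w']
        rw [this, mem_weightSpace, A.L_lie_v, zero_add]
        congr 1; push_cast; ring
      · have : w' (2 * k + 1) = 0 := by simp [w']
        rw [this]; exact Submodule.zero_mem _
    · simpa [v'] using hv0 0
    · simpa [w'] using (A.v ϱ (μ + K) b).ne_zero 0
    · intro m i j hij
      rcases Nat.even_or_odd' i with ⟨k, rfl | rfl⟩
      · obtain ⟨l, rfl⟩ : ∃ l, j = 2 * l := ⟨j / 2, by omega⟩
        refine ⟨μ + K + k + b * m, ?_, ?_⟩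
        · have h1 := hL m k l (by omega)
          simpa [v'] using h1
        · have h1 := A.L_lie_v ϱ (μ + K) b m k
          rw [show m + (k : ℤ) = l by omega] at h1
          simpa [w'] using h1
      · refine ⟨0, ?_, ?_⟩
        · simp [v']
        · simp [w']
    · intro n i j hij
      refine ⟨0, by rw [hY, zero_smul], ?_⟩
      rcases Nat.even_or_odd' i with ⟨k, rfl | rfl⟩
      · simpa [w'] using A.Y_lie_v ϱ (μ + K) b n k
      · simp [w']
  refine ⟨μ + K, b, ?_⟩
  by_cases hA : LieModule.IsIrreducible ℂ (W ϱ) (A ϱ (μ + K) b)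
  · exact Or.inl ⟨hA, nonempty_equiv_of_surjective hA hf⟩
  · exact Or.inr ⟨hA, hirr, hnt, N, f, hf⟩

/-- If `Y_{1/2}` is injective, then `ϱ` is `0` or `-1`. -/
theorem rho_eq_of_injective [Nontrivial V] (hw : IsWeightModule ϱ V)
    (hV : HasMultiplicityOne ϱ V) (hinj : ∀ v : V, ⁅Y ϱ 0, v⁆ = 0 → v = 0) :
    ϱ = 0 ∨ ϱ = -1 := by
  obtain ⟨μ, v₀, hv₀, hne⟩ := exists_weight_vector hw
  obtain ⟨v, a, F, hv0, -, ha0, -, hY, hL⟩ := exists_shift_basis hV hinj hv₀ hne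
  have hrel := shift_basis_relations (ε := fun m => (1 - 2 * m * ϱ) * a m) hv0 hY hL
  exact rho_eq_of_relations (by simp [ha0]) (fun _ => rfl) (fun m n => (hrel m n).2.1)
    fun m n => (hrel m n).1

end Identification

/-- If `ϱ = 0` and `Y_{1/2}` is injective, then `V` is a module `A_{a,b,c,c}` with `c ≠ 0`. -/
theorem exists_equiv_AA_of_injective {V : Type*} [AddCommGroup V] [Module ℂ V]
    [LieRingModule (W 0) V] [LieModule ℂ (W 0) V] (hirr : LieModule.IsIrreducible ℂ (W 0) V)
    (hw : IsWeightModule 0 V) (hV : HasMultiplicityOne 0 V)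
    (hinj : ∀ v : V, ⁅Y 0 0, v⁆ = 0 → v = 0) :
    ∃ a b c : ℂ, c ≠ 0 ∧ Nonempty (V ≃ₗ⁅ℂ, W 0⁆ AA a b c c) := by
  have : Nontrivial V := LieModule.nontrivial_of_isIrreducible ℂ (W 0) V
  obtain ⟨x₀, v₀, hv₀, hne⟩ := exists_weight_vector hw
  obtain ⟨v, a, F, hv0, hvmem, ha0, hF0, hY, hL⟩ := exists_shift_basis hV hinj hv₀ hne
  simp only [Rat.cast_zero, mul_zero, sub_zero, one_mul] at hL
  have hrel := shift_basis_relations hv0 hY hL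
  obtain ⟨τ, b, hτ, haτ, hFτ⟩ := coeff_of_relations ha0 hF0 (fun m n => (hrel m n).2.1)
    fun m n => (hrel m n).2.2
  -- the factors `τ ^ m` disappear in the basis `σ ^ j • v j` with `σ ^ 2 = τ`
  obtain ⟨σ, hσ⟩ := IsAlgClosed.exists_pow_nat_eq τ (n := 2) (by norm_num)
  have hσ0 : σ ≠ 0 := by
    rintro rfl
    exact hτ (by rw [← hσ]; norm_num)
  have hpow : ∀ (m : ℤ) (i j : ℕ), (j : ℤ) = i + 2 * m → σ ^ i * τ ^ m = σ ^ j := by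
    intro m i j hij
    rw [← hσ, ← zpow_natCast σ i, ← zpow_natCast σ j, hij, zpow_add₀ hσ0, zpow_mul]
    rfl
  refine ⟨x₀, b, σ⁻¹, inv_ne_zero hσ0, ?_⟩
  obtain ⟨N, f, hf⟩ : ∃ (N : LieSubmodule ℂ (W 0) (AA x₀ b σ⁻¹ σ⁻¹)) (f : N →ₗ⁅ℂ, W 0⁆ V),
      Function.Surjective f := by
    refine exists_surjective_of_match hirr (μ := x₀) (v := fun j => σ ^ j • v j)
      (w := fun j => AA.v x₀ b σ⁻¹ σ⁻¹ j) ?_ ?_ ?_ ?_ ?_ ?_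
    · exact fun j => Submodule.smul_mem _ _ (hvmem j)
    · intro j
      rw [mem_weightSpace, AA.L_lie_v]
      simp
    · simpa using hv0 0
    · exact (AA.v x₀ b σ⁻¹ σ⁻¹).ne_zero _
    · intro m i j hij
      refine ⟨x₀ + b * m + (i : ℂ) / 2, ?_, ?_⟩
      · rw [lie_smul, hL m i j hij, hFτ, haτ, smul_smul, smul_smul, ← hpow m i j hij]
        congr 1; ring
      · rw [AA.L_lie_v, hij, add_comm (i : ℤ)]
        push_cast; rfl
    · intro n i j hij
      refine ⟨σ⁻¹, ?_, ?_⟩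
      · have h1 : σ ^ (i + 1) * τ ^ n = σ ^ j := hpow n (i + 1) j (by push_cast; omega)
        rw [lie_smul, hY n i j hij, haτ, smul_smul, smul_smul, ← h1, pow_succ]
        congr 1; field_simp
      · rw [AA.Y_lie_v, ite_self]
        congr 2; omega
  exact nonempty_equiv_of_surjective
    (AA.isIrreducible x₀ b (mul_ne_zero (inv_ne_zero hσ0) (inv_ne_zero hσ0))) hf

end WRho

theorem theorem3p4 :
    (∀ (V : Type*) [AddCommGroup V] [Module ℂ V] [LieRingModule (WRho.W 0) V]
      [LieModule ℂ (WRho.W 0) V],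
      LieModule.IsIrreducible ℂ (WRho.W 0) V → ¬ LieModule.IsTrivial (WRho.W 0) V →
      WRho.IsWeightModule 0 V → WRho.HasMultiplicityOne 0 V →
      ∃ a b c₁ c₂ : ℂ, WRho.IsoAA' V a b c₁ c₂) ∧
    (∀ (ϱ : ℚ), ϱ ≠ 0 → ϱ ≠ -1 →
      ∀ (V : Type*) [AddCommGroup V] [Module ℂ V] [LieRingModule (WRho.W ϱ) V]
      [LieModule ℂ (WRho.W ϱ) V],
      LieModule.IsIrreducible ℂ (WRho.W ϱ) V → ¬ LieModule.IsTrivial (WRho.W ϱ) V →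
      WRho.IsWeightModule ϱ V → WRho.HasMultiplicityOne ϱ V →
      ∃ a b : ℂ, WRho.IsoA' ϱ V a b) := by
  constructor
  · intro V _ _ _ _ hirr hnt hw hV
    by_cases hY : ∃ (n : ℤ) (v : V), ⁅WRho.Y 0 n, v⁆ ≠ 0
    · obtain ⟨μ, hμ⟩ := WRho.exists_unbounded_coset hirr hnt hw hV
      obtain ⟨a, b, c, hc, he⟩ := WRho.exists_equiv_AA_of_injective hirr hw hV
        fun v hv => WRho.Y_zero_injective hirr hV (by norm_num) hY hμ hv
      exact ⟨a, b, c, c, Or.inl ⟨mul_ne_zero hc hc, he⟩⟩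
    · push Not at hY
      obtain ⟨a, b, h⟩ := WRho.exists_isoA'_of_Y_lie_eq_zero hirr hnt hw hV hY
      exact ⟨a, b, 0, 0, Or.inr ⟨mul_zero 0, h⟩⟩
  · intro ϱ h0 h1 V _ _ _ _ hirr hnt hw hV
    by_cases hY : ∃ (n : ℤ) (v : V), ⁅WRho.Y ϱ n, v⁆ ≠ 0
    · have : Nontrivial V := LieModule.nontrivial_of_isIrreducible ℂ (WRho.W ϱ) V
      obtain ⟨μ, hμ⟩ := WRho.exists_unbounded_coset hirr hnt hw hV
      have := WRho.rho_eq_of_injective hw hV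
        fun v hv => WRho.Y_zero_injective hirr hV h1 hY hμ hv
      exact absurd this (not_or.2 ⟨h0, h1⟩)
    · push Not at hY
      exact WRho.exists_isoA'_of_Y_lie_eq_zero hirr hnt hw hV hY
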